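/- Let $0<r<R<\infty$, let $\delta\in\mathbb{R}$ and $\nu\ge|\delta|$. For $x>0$ put $j_{\nu,\delta}(x)=x^{-\delta}J_\nu(x)$ and $y_{\nu,\delta}(x)=x^{-\delta}Y_\nu(x)$, where $J_\nu$ and $Y_\nu$ are the Bessel functions of the first and second kind of order $\nu$, and $$\mathfrak{h}_{\nu,\delta}(x)=j_{\nu,\delta}'(Rx)\,y_{\nu,\delta}'(rx)-j_{\nu,\delta}'(rx)\,y_{\nu,\delta}'(Rx),\qquad x>0.$$ Then the positive zeros of $\mathfrak{h}_{\nu,\delta}$ form a strictly increasing infinite sequence $x''_{\nu,k}$, where the index $k$ starts at $k=0$ if $\nu>|\delta|$ and at $k=1$ if $\nu=|\delta|$, and with this numbering $$x''_{\nu,k}=\frac{\pi}{R-r}\,k+O\!\left(\frac1k\right)\qquad (k\to\infty),$$ that is, there are constants $C$ and $K$, depending only on $\nu,\delta,R,r$, such that $\left|x''_{\nu,k}-\frac{\pi k}{R-r}\right|\le \frac{C}{k}$ for all $k\ge K$. -/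

import Mathlib

namespace BesselCross

/-- The Bessel function of the first kind `J_ν(x)`, for real order `ν` and `x > 0`, by its power
series. At the poles of `Γ` the value `Real.Gamma = 0` gives the usual reading `1 / Γ = 0`. -/
noncomputable def besselJ (ν x : ℝ) : ℝ :=
  ∑' m : ℕ, (-1 : ℝ) ^ m / ((m.factorial : ℝ) * Real.Gamma ((m : ℝ) + ν + 1)) *
    (x / 2) ^ (2 * (m : ℝ) + ν)

/-- The digamma function at a positive integer: `ψ(m + 1) = -γ + H_m`. -/
noncomputable def digammaSucc (m : ℕ) : ℝ :=
  -Real.eulerMascheroniConstant + (harmonic m : ℝ)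

/-- The Bessel function of the second kind `Y_n(x)` of integer order `n ≥ 0`, `x > 0`, i.e.
`lim_{μ → n} (J_μ(x) cos(πμ) - J_{-μ}(x)) / sin(πμ)`, by its classical series
`Y_n(x) = (2/π) log(x/2) J_n(x) - (1/π) ∑_{k < n} ((n-k-1)!/k!) (x/2)^(2k-n)
  - (1/π) ∑_{k ≥ 0} (-1)^k (ψ(k+1) + ψ(n+k+1)) / (k! (n+k)!) (x/2)^(2k+n)`. -/
noncomputable def besselYNat (n : ℕ) (x : ℝ) : ℝ :=
  2 / Real.pi * Real.log (x / 2) * besselJ n x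
    - 1 / Real.pi * ∑ k ∈ Finset.range n,
        ((n - k - 1).factorial : ℝ) / (k.factorial : ℝ) * (x / 2) ^ (2 * (k : ℤ) - (n : ℤ))
    - 1 / Real.pi * ∑' k : ℕ,
        (-1 : ℝ) ^ k * (digammaSucc k + digammaSucc (n + k)) /
          ((k.factorial : ℝ) * ((n + k).factorial : ℝ)) * (x / 2) ^ (2 * k + n)

open Classical in
/-- The Bessel function of the second kind `Y_ν(x)`, for real order `ν ≥ 0` and `x > 0`. -/
noncomputable def besselY (ν x : ℝ) : ℝ :=
  if (⌊ν⌋₊ : ℝ) = ν then besselYNat ⌊ν⌋₊ x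
  else (besselJ ν x * Real.cos (Real.pi * ν) - besselJ (-ν) x) / Real.sin (Real.pi * ν)

/-- `j_{ν,δ}(x) = x^{-δ} J_ν(x)`. -/
noncomputable def ultraJ (ν δ x : ℝ) : ℝ := x ^ (-δ) * besselJ ν x

/-- `y_{ν,δ}(x) = x^{-δ} Y_ν(x)`. -/
noncomputable def ultraY (ν δ x : ℝ) : ℝ := x ^ (-δ) * besselY ν x

/-- The cross-product `h_{ν,δ}(x) = j'(Rx) y'(rx) - j'(rx) y'(Rx)`. -/
noncomputable def crossH (R r ν δ x : ℝ) : ℝ :=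
  deriv (ultraJ ν δ) (R * x) * deriv (ultraY ν δ) (r * x)
    - deriv (ultraJ ν δ) (r * x) * deriv (ultraY ν δ) (R * x)

open Classical in
/-- The index of the first positive zero: `0` if `ν > |δ|`, and `1` if `ν = |δ|`. -/
noncomputable def firstIndex (ν δ : ℝ) : ℕ := if |δ| < ν then 0 else 1

/-- `z` lists all positive zeros of `h_{ν,δ}` in increasing order, the first having index
`firstIndex ν δ`. (The values of `z` below that index are irrelevant; on the indices from
there on, such a `z` is unique.) -/
def IsPositiveZeroSequence (R r ν δ : ℝ) (z : ℕ → ℝ) : Prop :=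
  StrictMonoOn z (Set.Ici (firstIndex ν δ)) ∧
    z '' Set.Ici (firstIndex ν δ) = {x : ℝ | 0 < x ∧ crossH R r ν δ x = 0}

end BesselCross

namespace BesselCross

open Filter Topology

/-! For fixed `x`, put `u = a j + b y` with `a = y'(rx)` and `b = -j'(rx)`. Then `u'(rx) = 0` and
the cross-product at `x` is `u'(Rx)`, so its zeros are the `x` for which a solution of `u'' +
(2δ+1)/t u' + (1 - (ν² - δ²)/t²) u = 0` with a critical point at `rx` has another at `Rx`. By the
Wronskian, `u` is nontrivial and never vanishes together with `u'`.

Write `u(xρ) = C cos θ`, `u'(xρ) = -C sin θ` with `θ = 0` at `ρ = r`. The phase satisfies `θ' = x -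
μ/(xρ²) cos² θ - (κ/ρ) sin 2θ`, where `μ = ν² - δ² ≥ 0` and `κ = δ + 1/2`, and the zeros are the `x`
with `Θ(x) = θ(x, R)` in `πℤ`. The field increases with `x`, so `Θ` is strictly increasing by
comparison (`phase_comparison`); it is continuous by Gronwall. The `sin 2θ` term oscillates and
averages out to order `1/x`, so `Θ(x) = (R - r) x + O(1/x)` (`IsPhase.asymptotic`). Each multiple of
`π` above the infimum of `Θ` is thus attained once, and inverting the asymptotics locates it
(`exists_zero_sequence`).

The numbering depends on `Θ` near `0`: always `Θ > -π`; for `μ > 0` it takes negative values, so the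
first multiple is `0`; for `μ = 0` it is positive and tends to `0`, so the first is `π`. -/

/-! ### Everywhere convergent power series -/

/-- A real coefficient sequence whose power series converges absolutely everywhere. -/
def Entire (g : ℕ → ℝ) : Prop := ∀ ρ : ℝ, 0 ≤ ρ → Summable fun k => |g k| * ρ ^ k

/-- The sum of the power series with coefficients `g`. -/
noncomputable def seriesSum (g : ℕ → ℝ) (q : ℝ) : ℝ := ∑' k, g k * q ^ k

lemma Entire.summable {g : ℕ → ℝ} (hg : Entire g) (q : ℝ) : Summable fun k => g k * q ^ k := by
  refine Summable.of_norm ?_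
  simpa [abs_mul, abs_pow] using hg |q| (abs_nonneg q)

lemma Entire.add {g h : ℕ → ℝ} (hg : Entire g) (hh : Entire h) :
    Entire fun k => g k + h k := by
  intro ρ hρ
  refine Summable.of_nonneg_of_le (fun k => by positivity) (fun k => ?_)
    ((hg ρ hρ).add (hh ρ hρ))
  rw [← add_mul]
  exact mul_le_mul_of_nonneg_right (abs_add_le _ _) (by positivity)

lemma Entire.const_mul {g : ℕ → ℝ} (hg : Entire g) (c : ℝ) : Entire fun k => c * g k := by
  intro ρ hρ
  simpa [abs_mul, mul_assoc] using (hg ρ hρ).mul_left |c|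

lemma Entire.nat_mul {g : ℕ → ℝ} (hg : Entire g) : Entire fun k => (k : ℝ) * g k := by
  intro ρ hρ
  refine Summable.of_nonneg_of_le (fun k => by positivity) (fun k => ?_)
    (hg (2 * ρ) (by positivity))
  have h : (k : ℝ) ≤ 2 ^ k := by exact_mod_cast Nat.lt_two_pow_self.le
  rw [abs_mul, Nat.abs_cast, mul_pow]
  calc (k : ℝ) * |g k| * ρ ^ k = k * (|g k| * ρ ^ k) := by ring
    _ ≤ 2 ^ k * (|g k| * ρ ^ k) := mul_le_mul_of_nonneg_right h (by positivity)
    _ = _ := by ring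

lemma Entire.linear_mul {g : ℕ → ℝ} (hg : Entire g) (s : ℝ) :
    Entire fun k => (s + 2 * (k : ℝ)) * g k := by
  have := (hg.const_mul s).add (hg.nat_mul.const_mul 2)
  have e : (fun k : ℕ => (s + 2 * (k : ℝ)) * g k) = fun k : ℕ => s * g k + 2 * ((k : ℝ) * g k) := by
    funext k; ring
  rwa [e]

/-- Allows finitely many exceptional coefficients to be ignored: those near poles of `Γ`, or the
finite sum in `Y_n`. -/
lemma entire_iff_nat_add {g : ℕ → ℝ} (n : ℕ) : Entire (fun k => g (k + n)) ↔ Entire g := by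
  constructor
  · intro h ρ hρ
    rw [← summable_nat_add_iff n]
    refine ((h ρ hρ).mul_right (ρ ^ n)).congr fun k => ?_
    rw [pow_add]; ring
  · intro h ρ hρ
    have h1 := (summable_nat_add_iff n).2 (h (ρ + 1) (by positivity))
    refine Summable.of_nonneg_of_le (fun k => by positivity) (fun k => ?_) h1
    refine mul_le_mul_of_nonneg_left ?_ (abs_nonneg _)
    calc ρ ^ k ≤ (ρ + 1) ^ k := by gcongr; linarith
      _ ≤ (ρ + 1) ^ (k + n) := pow_le_pow_right₀ (by linarith) (by omega)

/-- A sequence bounded by `C k / k!` up to a shift is entire. -/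
lemma entire_of_abs_le {g : ℕ → ℝ} {C : ℝ} (n : ℕ)
    (h : ∀ k ≥ n, |g k| ≤ C * ((k : ℝ) + 1) / (k.factorial : ℝ)) : Entire g := by
  have h0 : Entire fun k => C * (((k : ℕ) : ℝ) + 1) / (k.factorial : ℝ) := by
    have e : Entire fun k : ℕ => 1 / (k.factorial : ℝ) := by
      intro ρ hρ
      refine (Real.summable_pow_div_factorial ρ).congr fun k => ?_
      rw [abs_of_nonneg (by positivity)]; ring
    have := (e.nat_mul.add e).const_mul C
    refine cast (congrArg Entire ?_) this
    funext k; ring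
  rw [← entire_iff_nat_add n] at h0 ⊢
  intro ρ hρ
  refine Summable.of_nonneg_of_le (fun k => by positivity) (fun k => ?_) (h0 ρ hρ)
  exact mul_le_mul_of_nonneg_right ((h (k + n) (by omega)).trans (le_abs_self _)) (by positivity)

lemma seriesSum_zero (g : ℕ → ℝ) : seriesSum g 0 = g 0 := by
  unfold seriesSum
  rw [tsum_eq_single 0 (fun k hk => by simp [hk])]
  simp

lemma seriesSum_add {g h : ℕ → ℝ} (hg : Entire g) (hh : Entire h) (q : ℝ) :
    seriesSum (fun k => g k + h k) q = seriesSum g q + seriesSum h q := by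
  unfold seriesSum
  rw [← (hg.summable q).tsum_add (hh.summable q)]
  exact tsum_congr fun k => by ring

lemma seriesSum_const_mul (g : ℕ → ℝ) (c q : ℝ) :
    seriesSum (fun k => c * g k) q = c * seriesSum g q := by
  unfold seriesSum
  rw [← tsum_mul_left]
  exact tsum_congr fun k => by ring

/-- Multiplication of a power series by the `n`-th power of the variable. -/
def shiftSeq (n : ℕ) (g : ℕ → ℝ) (k : ℕ) : ℝ := if k < n then 0 else g (k - n)

lemma shiftSeq_add (n : ℕ) (g : ℕ → ℝ) (k : ℕ) : shiftSeq n g (k + n) = g k := by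
  simp [shiftSeq]

lemma Entire.shiftSeq {g : ℕ → ℝ} (hg : Entire g) (n : ℕ) : Entire (shiftSeq n g) := by
  rw [← entire_iff_nat_add n]
  simpa only [shiftSeq_add] using hg

lemma seriesSum_eq_sum_add {g : ℕ → ℝ} (hg : Entire g) (n : ℕ) (q : ℝ) :
    seriesSum g q = ∑ k ∈ Finset.range n, g k * q ^ k + q ^ n * seriesSum (fun k => g (k + n)) q := by
  unfold seriesSum
  rw [← (hg.summable q).sum_add_tsum_nat_add n, ← tsum_mul_left]
  congr 1
  exact tsum_congr fun k => by ring

lemma seriesSum_shiftSeq {g : ℕ → ℝ} (hg : Entire g) (n : ℕ) (q : ℝ) :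
    seriesSum (shiftSeq n g) q = q ^ n * seriesSum g q := by
  rw [seriesSum_eq_sum_add (hg.shiftSeq n) n]
  simp only [shiftSeq_add]
  rw [Finset.sum_eq_zero, zero_add]
  intro k hk
  simp [shiftSeq, Finset.mem_range.1 hk]

lemma hasDerivAt_seriesSum {g : ℕ → ℝ} (hg : Entire g) (q : ℝ) :
    HasDerivAt (seriesSum g) (∑' k, g k * ((k : ℝ) * q ^ (k - 1))) q := by
  set B : ℝ := |q| + 1
  have hB : 1 ≤ B := by simp [B]
  -- Termwise differentiation on the ball of radius `|q| + 1`; a radius at least `1` lets `B ^ k`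
  -- dominate `|y| ^ (k - 1)`.
  refine hasDerivAt_tsum_of_isPreconnected (u := fun k : ℕ => |(k : ℝ) * g k| * B ^ k)
    (t := Metric.ball 0 B) (y₀ := 0)
    (g := fun k y => g k * y ^ k) (g' := fun k y => g k * ((k : ℝ) * y ^ (k - 1))) (hg.nat_mul B (by positivity)) Metric.isOpen_ball
    (convex_ball (0 : ℝ) B).isPreconnected (fun k y _ => ?_) (fun k y hy => ?_) (Metric.mem_ball_self (by positivity))
    (hg.summable 0) (by simp [B])
  · exact (hasDerivAt_pow k y).const_mul (g k)
  · have hy' : |y| ≤ B := by simpa using (Metric.mem_ball.1 hy).le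
    rw [Real.norm_eq_abs, abs_mul, abs_mul, abs_mul, abs_pow]
    calc |g k| * (|(k : ℝ)| * |y| ^ (k - 1)) ≤ |g k| * (|(k : ℝ)| * B ^ k) := by
          gcongr
          calc |y| ^ (k - 1) ≤ B ^ (k - 1) := by gcongr
            _ ≤ B ^ k := pow_le_pow_right₀ hB (by omega)
      _ = _ := by ring

lemma continuous_seriesSum {g : ℕ → ℝ} (hg : Entire g) : Continuous (seriesSum g) :=
  continuous_iff_continuousAt.2 fun q => (hasDerivAt_seriesSum hg q).continuousAt

lemma mul_tsum_deriv (g : ℕ → ℝ) (q : ℝ) :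
    q * ∑' k, g k * ((k : ℝ) * q ^ (k - 1)) = seriesSum (fun k => (k : ℝ) * g k) q := by
  unfold seriesSum
  rw [← tsum_mul_left]
  refine tsum_congr fun k => ?_
  cases k with
  | zero => simp
  | succ k => simp only [Nat.add_sub_cancel, pow_succ]; ring

/-! ### Frobenius series and Bessel's equation -/

/-- The Frobenius series `(t/2)^s ∑ g_k (t/2)^(2k)`. -/
noncomputable def frobenius (s : ℝ) (g : ℕ → ℝ) (t : ℝ) : ℝ :=
  (t / 2) ^ s * seriesSum g ((t / 2) ^ 2)

lemma hasDerivAt_frobenius {g : ℕ → ℝ} (hg : Entire g) (s : ℝ) {t : ℝ} (ht : 0 < t) :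
    HasDerivAt (frobenius s g) (frobenius s (fun k => (s + 2 * (k : ℝ)) * g k) t / t) t := by
  have h1 : HasDerivAt (fun t : ℝ => t / 2) (1 / 2) t := (hasDerivAt_id t).div_const 2
  have h2 := h1.rpow_const (p := s) (Or.inl (by positivity))
  have h3 := (hasDerivAt_seriesSum hg ((t / 2) ^ 2)).comp t (h1.pow 2)
  have e1 : seriesSum (fun k => (s + 2 * (k : ℝ)) * g k) ((t / 2) ^ 2) =
      s * seriesSum g ((t / 2) ^ 2) + 2 * seriesSum (fun k => (k : ℝ) * g k) ((t / 2) ^ 2) := by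
    rw [← seriesSum_const_mul, ← seriesSum_const_mul,
      ← seriesSum_add (hg.const_mul s) (hg.nat_mul.const_mul 2)]
    congr 1; funext k; ring
  rw [← mul_tsum_deriv] at e1
  refine (h2.mul h3).congr_deriv ?_
  simp only [Function.comp_apply]
  unfold frobenius
  rw [e1, Real.rpow_sub_one (by positivity)]
  field_simp
  simp
  ring_nf

/-- The action of `t d/dt` on the coefficients of a Frobenius series with exponent `s`. -/
def eulerSeq (s : ℝ) (g : ℕ → ℝ) (k : ℕ) : ℝ := (s + 2 * (k : ℝ)) * g k

lemma Entire.eulerSeq {g : ℕ → ℝ} (hg : Entire g) (s : ℝ) : Entire (eulerSeq s g) :=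
  hg.linear_mul s

lemma hasDerivAt_frobenius_eulerSeq {g : ℕ → ℝ} (hg : Entire g) (s : ℝ) {t : ℝ} (ht : 0 < t) :
    HasDerivAt (frobenius s g) (frobenius s (eulerSeq s g) t / t) t :=
  hasDerivAt_frobenius hg s ht

/-- On coefficients, `(t d/dt)² - s²` multiplies by `(s + 2k)² - s² = 4k(k + s)`, and `t² = 4
(t/2)²` is four times a shift by one. The right-hand side `c` is needed for the logarithmic case. -/
lemma frobenius_ode {g c : ℕ → ℝ} {s : ℝ} (hg : Entire g)
    (h : ∀ k : ℕ, 4 * (k : ℝ) * (k + s) * g k + 4 * shiftSeq 1 g k = c k) (t : ℝ) :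
    frobenius s (eulerSeq s (eulerSeq s g)) t + (t ^ 2 - s ^ 2) * frobenius s g t =
      frobenius s c t := by
  have hc : c = fun k => (eulerSeq s (eulerSeq s g) k + (-s ^ 2) * g k) + 4 * shiftSeq 1 g k := by
    funext k
    rw [← h k]; unfold eulerSeq; ring
  have e : seriesSum c ((t / 2) ^ 2) = seriesSum (eulerSeq s (eulerSeq s g)) ((t / 2) ^ 2) +
      (t ^ 2 - s ^ 2) * seriesSum g ((t / 2) ^ 2) := by
    rw [hc, seriesSum_add (((hg.eulerSeq s).eulerSeq s).add (hg.const_mul _))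
      ((hg.shiftSeq 1).const_mul 4), seriesSum_add ((hg.eulerSeq s).eulerSeq s) (hg.const_mul _),
      seriesSum_const_mul, seriesSum_const_mul, seriesSum_shiftSeq hg]
    ring
  unfold frobenius
  rw [e]
  ring

/-- `f` solves Bessel's equation of order `ν` on `(0, ∞)`, with derivative `f'`. -/
structure IsBesselPair (ν : ℝ) (f f' : ℝ → ℝ) : Prop where
  hasDerivAt : ∀ t > 0, HasDerivAt f (f' t) t
  hasDerivAt' : ∀ t > 0, HasDerivAt f' (-(f' t) / t - (1 - ν ^ 2 / t ^ 2) * f t) t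

lemma IsBesselPair.congr {ν : ℝ} {f g f' : ℝ → ℝ} (h : IsBesselPair ν f f')
    (hfg : ∀ t > 0, g t = f t) : IsBesselPair ν g f' where
  hasDerivAt t ht := (h.hasDerivAt t ht).congr_of_eventuallyEq <| by
    filter_upwards [Ioi_mem_nhds ht] with u hu using hfg u hu
  hasDerivAt' t ht := by
    rw [hfg t ht]
    exact h.hasDerivAt' t ht

lemma IsBesselPair.linear_comb {ν : ℝ} {f g f' g' : ℝ → ℝ} (hf : IsBesselPair ν f f')
    (hg : IsBesselPair ν g g') (a b : ℝ) :
    IsBesselPair ν (fun t => a * f t + b * g t) (fun t => a * f' t + b * g' t) where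
  hasDerivAt t ht := ((hf.hasDerivAt t ht).const_mul a).add ((hg.hasDerivAt t ht).const_mul b)
  hasDerivAt' t ht := by
    refine (((hf.hasDerivAt' t ht).const_mul a).add
      ((hg.hasDerivAt' t ht).const_mul b)).congr_deriv ?_
    ring

lemma hasDerivAt_frobenius_deriv {g : ℕ → ℝ} {s t : ℝ} (hg : Entire g) (ht : 0 < t) :
    HasDerivAt (fun t => frobenius s (eulerSeq s g) t / t)
      ((frobenius s (eulerSeq s (eulerSeq s g)) t - frobenius s (eulerSeq s g) t) / t ^ 2) t := by
  refine ((hasDerivAt_frobenius_eulerSeq (hg.eulerSeq s) s ht).div (hasDerivAt_id t)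
    ht.ne').congr_deriv ?_
  simp only [id]
  field_simp

lemma isBesselPair_frobenius {g : ℕ → ℝ} {s ν : ℝ} (hg : Entire g) (hν : ν ^ 2 = s ^ 2)
    (h : ∀ k : ℕ, ((k : ℝ) + 1) * (k + 1 + s) * g (k + 1) + g k = 0) :
    IsBesselPair ν (frobenius s g) (fun t => frobenius s (eulerSeq s g) t / t) where
  hasDerivAt t ht := hasDerivAt_frobenius_eulerSeq hg s ht
  hasDerivAt' t ht := by
    refine (hasDerivAt_frobenius_deriv hg ht).congr_deriv ?_
    have e := frobenius_ode (c := fun _ => 0) hg (s := s) (fun k => ?_) t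
    · have e0 : frobenius s (fun _ => 0) t = 0 := by simp [frobenius, seriesSum]
      rw [e0] at e
      rw [hν]
      field_simp
      linear_combination e
    · cases k with
      | zero => simp [shiftSeq]
      | succ k =>
        have := h k
        simp only [shiftSeq_add]
        push_cast
        linear_combination 4 * this

/-! ### The function of the first kind -/

/-- The coefficients of the Bessel function of the first kind. -/
noncomputable def besselCoeff (ν : ℝ) (m : ℕ) : ℝ :=
  (-1 : ℝ) ^ m / ((m.factorial : ℝ) * Real.Gamma ((m : ℝ) + ν + 1))

lemma besselJ_eq_frobenius (ν : ℝ) {t : ℝ} (ht : 0 < t) :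
    besselJ ν t = frobenius ν (besselCoeff ν) t := by
  unfold besselJ frobenius seriesSum
  rw [← tsum_mul_left]
  refine tsum_congr fun m => ?_
  rw [Real.rpow_add (by positivity), ← pow_mul, ← Real.rpow_natCast (t / 2) (2 * m)]
  push_cast
  unfold besselCoeff
  ring

lemma entire_besselCoeff (ν : ℝ) : Entire (besselCoeff ν) := by
  -- From `k ≥ 1 - ν` on, the argument of `Γ` is at least `2`, where `Γ` increases from `Γ(2) = 1`.
  obtain ⟨n, hn⟩ := exists_nat_ge (1 - ν)
  refine entire_of_abs_le (C := 1) n fun k hk => ?_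
  have hk' : (n : ℝ) ≤ k := by exact_mod_cast hk
  have hΓ : 1 ≤ Real.Gamma ((k : ℝ) + ν + 1) := by
    refine Real.Gamma_two.symm.trans_le ?_
    exact Real.Gamma_strictMonoOn_Ici.monotoneOn (Set.mem_Ici.2 le_rfl)
      (Set.mem_Ici.2 (by linarith)) (by linarith)
  unfold besselCoeff
  rw [abs_div, abs_pow, abs_neg, abs_one, one_pow, one_mul, abs_of_pos (by positivity)]
  calc 1 / ((k.factorial : ℝ) * Real.Gamma ((k : ℝ) + ν + 1)) ≤ 1 / ((k.factorial : ℝ) * 1) := by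
        gcongr
    _ ≤ ((k : ℝ) + 1) / (k.factorial : ℝ) := by
        rw [mul_one]; gcongr; linarith [(Nat.cast_nonneg k : (0 : ℝ) ≤ k)]

lemma besselCoeff_succ {ν : ℝ} {k : ℕ} (h : (k : ℝ) + 1 + ν ≠ 0) :
    ((k : ℝ) + 1) * (k + 1 + ν) * besselCoeff ν (k + 1) + besselCoeff ν k = 0 := by
  have hk : (k : ℝ) + 1 ≠ 0 := by positivity
  have e : Real.Gamma (((k + 1 : ℕ) : ℝ) + ν + 1) =
      ((k : ℝ) + 1 + ν) * Real.Gamma ((k : ℝ) + ν + 1) := by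
    rw [show ((k + 1 : ℕ) : ℝ) + ν + 1 = ((k : ℝ) + 1 + ν) + 1 by push_cast; ring,
      Real.Gamma_add_one h, show (k : ℝ) + 1 + ν = (k : ℝ) + ν + 1 by ring]
  unfold besselCoeff
  rw [e, Nat.factorial_succ, pow_succ]
  push_cast
  have hf : (k.factorial : ℝ) ≠ 0 := by positivity
  -- At a pole `Real.Gamma` is `0`, so both coefficients vanish.
  by_cases hΓ : Real.Gamma ((k : ℝ) + ν + 1) = 0
  · simp [hΓ]
  · field_simp
    ring

lemma isBesselPair_besselJ {ν μ : ℝ} (hμ : μ ^ 2 = ν ^ 2) (h : ∀ k : ℕ, (k : ℝ) + 1 + ν ≠ 0) :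
    IsBesselPair μ (besselJ ν) (fun t => frobenius ν (eulerSeq ν (besselCoeff ν)) t / t) :=
  (isBesselPair_frobenius (entire_besselCoeff ν) hμ fun k => besselCoeff_succ (h k)).congr
    fun _ ht => besselJ_eq_frobenius ν ht

/-! ### Wronskians -/

/-- Abel's identity: `t` times the Wronskian is constant; its value is the limit at `0`. -/
lemma IsBesselPair.wronskian {ν c : ℝ} {f g f' g' : ℝ → ℝ} (hf : IsBesselPair ν f f')
    (hg : IsBesselPair ν g g')
    (hlim : Tendsto (fun t => t * (f t * g' t - f' t * g t)) (𝓝[>] 0) (𝓝 c)) {t : ℝ} (ht : 0 < t) :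
    t * (f t * g' t - f' t * g t) = c := by
  have hd : ∀ s > 0, HasDerivAt (fun t => t * (f t * g' t - f' t * g t)) 0 s := by
    intro s hs
    refine ((hasDerivAt_id s).mul (((hf.hasDerivAt s hs).mul (hg.hasDerivAt' s hs)).sub
      ((hf.hasDerivAt' s hs).mul (hg.hasDerivAt s hs)))).congr_deriv ?_
    simp only [id, Pi.mul_apply, Pi.sub_apply]
    field_simp
    ring
  have hconst : ∀ s > 0, s * (f s * g' s - f' s * g s) = t * (f t * g' t - f' t * g t) := by
    intro s hs
    exact isOpen_Ioi.is_const_of_deriv_eq_zero (convex_Ioi (0 : ℝ)).isPreconnected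
      (fun u hu => (hd u hu).differentiableAt.differentiableWithinAt)
      (fun u hu => (hd u hu).deriv) hs ht
  refine tendsto_nhds_unique (Tendsto.congr' ?_ tendsto_const_nhds) hlim
  filter_upwards [self_mem_nhdsWithin] with s hs using (hconst s hs).symm

/-- The powers `(t/2)^s` and `(t/2)^(-s)` cancel and `t` absorbs the `1/t`, leaving a continuous
function of `t`; only the constant coefficients survive at `0`. -/
lemma tendsto_frobenius_wronskian {a b : ℕ → ℝ} (ha : Entire a) (hb : Entire b) (s : ℝ) :
    Tendsto (fun t => t * (frobenius s a t * (frobenius (-s) (eulerSeq (-s) b) t / t) -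
      frobenius s (eulerSeq s a) t / t * frobenius (-s) b t)) (𝓝[>] 0)
      (𝓝 (-2 * s * a 0 * b 0)) := by
  set F : ℝ → ℝ := fun t => seriesSum a ((t / 2) ^ 2) * seriesSum (eulerSeq (-s) b) ((t / 2) ^ 2) -
    seriesSum (eulerSeq s a) ((t / 2) ^ 2) * seriesSum b ((t / 2) ^ 2) with hF
  have h1 := continuous_seriesSum ha
  have h2 := continuous_seriesSum hb
  have h3 := continuous_seriesSum (ha.eulerSeq s)
  have h4 := continuous_seriesSum (hb.eulerSeq (-s))
  have hc : Continuous F := by fun_prop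
  have h0 : F 0 = -2 * s * a 0 * b 0 := by
    simp only [hF, zero_div, ne_eq, OfNat.ofNat_ne_zero, not_false_eq_true, zero_pow,
      seriesSum_zero, eulerSeq, Nat.cast_zero, mul_zero, add_zero]
    ring
  rw [← h0]
  refine Tendsto.congr' ?_ ((hc.tendsto 0).mono_left nhdsWithin_le_nhds)
  filter_upwards [self_mem_nhdsWithin] with t ht
  have ht0 : (0 : ℝ) < t := ht
  have e : (t / 2) ^ s * (t / 2) ^ (-s) = 1 := by
    rw [← Real.rpow_add (by positivity), add_neg_cancel, Real.rpow_zero]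
  simp only [hF, frobenius]
  generalize seriesSum a ((t / 2) ^ 2) = A
  generalize seriesSum b ((t / 2) ^ 2) = B
  generalize seriesSum (eulerSeq s a) ((t / 2) ^ 2) = A'
  generalize seriesSum (eulerSeq (-s) b) ((t / 2) ^ 2) = B'
  field_simp
  linear_combination (A' * B - A * B') * e

/-! ### The function of the second kind at integer order -/

/-- The coefficients of the non-logarithmic part `(t/2)^(-n) ∑ b_k (t/2)^(2k)` of `Y_n`. -/
noncomputable def weberCoeff (n k : ℕ) : ℝ :=
  if k < n then -(1 / Real.pi) * (((n - k - 1).factorial : ℝ) / (k.factorial : ℝ))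
  else -(1 / Real.pi) * ((-1 : ℝ) ^ (k - n) * (digammaSucc (k - n) + digammaSucc k) /
    (((k - n).factorial : ℝ) * (k.factorial : ℝ)))

lemma weberCoeff_add (n m : ℕ) : weberCoeff n (m + n) =
    -(1 / Real.pi) * ((-1 : ℝ) ^ m * (digammaSucc m + digammaSucc (n + m)) /
      ((m.factorial : ℝ) * ((n + m).factorial : ℝ))) := by
  simp [weberCoeff, add_comm n m]

lemma digammaSucc_succ (m : ℕ) : digammaSucc (m + 1) = digammaSucc m + 1 / ((m : ℝ) + 1) := by
  unfold digammaSucc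
  rw [harmonic_succ]
  push_cast
  ring

lemma abs_digammaSucc_le (m : ℕ) : |digammaSucc m| ≤ (m : ℝ) + 1 := by
  induction m with
  | zero =>
    simp only [digammaSucc, harmonic_zero, Rat.cast_zero, add_zero, abs_neg, Nat.cast_zero]
    rw [abs_of_pos (by linarith [Real.one_half_lt_eulerMascheroniConstant])]
    linarith [Real.eulerMascheroniConstant_lt_two_thirds]
  | succ m ih =>
    rw [digammaSucc_succ]
    refine (abs_add_le _ _).trans ?_
    have h1 : |1 / ((m : ℝ) + 1)| ≤ 1 := by
      rw [abs_of_pos (by positivity), div_le_one (by positivity)]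
      linarith [(Nat.cast_nonneg m : (0 : ℝ) ≤ m)]
    push_cast
    linarith

lemma entire_weberCoeff (n : ℕ) : Entire (weberCoeff n) := by
  rw [← entire_iff_nat_add n]
  refine entire_of_abs_le (C := n + 2) 0 fun m _ => ?_
  rw [weberCoeff_add, abs_mul, abs_div, abs_mul, abs_pow, abs_neg, abs_neg, abs_one, one_pow,
    one_mul, abs_of_pos (by positivity : 0 < 1 / Real.pi),
    abs_of_pos (by positivity : 0 < (m.factorial : ℝ) * ((n + m).factorial : ℝ))]
  have h1 : |digammaSucc m + digammaSucc (n + m)| ≤ ((n : ℝ) + 2) * (m + 1) := by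
    refine (abs_add_le _ _).trans ((add_le_add (abs_digammaSucc_le _)
      (abs_digammaSucc_le _)).trans ?_)
    push_cast
    nlinarith [(Nat.cast_nonneg m : (0 : ℝ) ≤ m), (Nat.cast_nonneg n : (0 : ℝ) ≤ n),
      mul_nonneg (Nat.cast_nonneg n : (0 : ℝ) ≤ n) (Nat.cast_nonneg m : (0 : ℝ) ≤ m)]
  have h2 : (1 : ℝ) ≤ ((n + m).factorial : ℝ) := by
    exact_mod_cast Nat.succ_le_of_lt (Nat.factorial_pos _)
  have h3 : 1 / Real.pi ≤ 1 := by
    rw [div_le_one Real.pi_pos]; linarith [Real.pi_gt_three]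
  calc 1 / Real.pi * (|digammaSucc m + digammaSucc (n + m)| /
        ((m.factorial : ℝ) * ((n + m).factorial : ℝ)))
      ≤ 1 * (((n : ℝ) + 2) * (m + 1) / ((m.factorial : ℝ) * 1)) := by gcongr
    _ = _ := by rw [one_mul, mul_one]

lemma besselYNat_eq (n : ℕ) {t : ℝ} (ht : 0 < t) :
    besselYNat n t = 2 / Real.pi * (Real.log (t / 2) * besselJ n t) +
      frobenius (-n) (weberCoeff n) t := by
  have ht2 : 0 < t / 2 := by positivity
  unfold besselYNat frobenius
  rw [seriesSum_eq_sum_add (entire_weberCoeff n) n, mul_add]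
  have e1 : (t / 2) ^ (-(n : ℝ)) * ∑ k ∈ Finset.range n, weberCoeff n k * ((t / 2) ^ 2) ^ k =
      -(1 / Real.pi * ∑ k ∈ Finset.range n, ((n - k - 1).factorial : ℝ) / (k.factorial : ℝ) *
        (t / 2) ^ (2 * (k : ℤ) - (n : ℤ))) := by
    rw [Finset.mul_sum, Finset.mul_sum, ← Finset.sum_neg_distrib]
    refine Finset.sum_congr rfl fun k hk => ?_
    rw [weberCoeff, if_pos (Finset.mem_range.1 hk), zpow_sub₀ ht2.ne', zpow_natCast,
      Real.rpow_neg ht2.le, Real.rpow_natCast, ← pow_mul, zpow_mul, zpow_ofNat, zpow_natCast,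
      ← pow_mul]
    ring
  have e2 : (t / 2) ^ (-(n : ℝ)) * (((t / 2) ^ 2) ^ n *
      seriesSum (fun k => weberCoeff n (k + n)) ((t / 2) ^ 2)) =
      -(1 / Real.pi * ∑' k : ℕ, (-1 : ℝ) ^ k * (digammaSucc k + digammaSucc (n + k)) /
          ((k.factorial : ℝ) * ((n + k).factorial : ℝ)) * (t / 2) ^ (2 * k + n)) := by
    unfold seriesSum
    rw [← tsum_mul_left, ← tsum_mul_left, ← tsum_mul_left, ← tsum_neg]
    refine tsum_congr fun k => ?_
    simp only [weberCoeff_add]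
    rw [Real.rpow_neg ht2.le, Real.rpow_natCast, pow_add, ← pow_mul, ← pow_mul,
      mul_comm 2 n, pow_mul (t / 2) n 2]
    field_simp
  rw [e1, e2]
  ring

/-- The operator `(t d/dt)² + t² - n²` sends `(2/π) log(t/2) J_n` to `(4/π) t J_n'`, so the rest of
`Y_n` must produce `-(4/π) t J_n'`. That function has exponent `n`, whence the shift by `n`. The
cases `k < n`, `k = n` (where the factor `k - n` vanishes) and `k > n` (the digamma recurrence) are
separate. -/
lemma weberCoeff_ode (n k : ℕ) :
    4 * (k : ℝ) * (k + (-(n : ℝ))) * weberCoeff n k + 4 * shiftSeq 1 (weberCoeff n) k =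
      -(4 / Real.pi) * shiftSeq n (eulerSeq n (besselCoeff n)) k := by
  have hπ := Real.pi_ne_zero
  cases k with
  | zero =>
    cases n with
    | zero => simp [shiftSeq, eulerSeq]
    | succ n => simp [shiftSeq]
  | succ j =>
    rw [shiftSeq_add]
    rcases lt_trichotomy (j + 1) n with h | h | h
    · obtain ⟨d, rfl⟩ : ∃ d, n = j + d + 2 := ⟨n - j - 2, by omega⟩
      have e1 : j + d + 2 - (j + 1) - 1 = d := by omega
      have e2 : j + d + 2 - j - 1 = d + 1 := by omega
      simp only [weberCoeff, shiftSeq, if_pos h, if_pos (show j < j + d + 2 by omega), e1, e2,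
        Nat.factorial_succ]
      push_cast
      field_simp
      ring
    · subst h
      simp only [weberCoeff, shiftSeq, lt_irrefl, if_false, if_pos (Nat.lt_succ_self j),
        Nat.sub_self, eulerSeq, besselCoeff]
      have e1 : Real.Gamma (((0 : ℕ) : ℝ) + ((j + 1 : ℕ) : ℝ) + 1) =
          ((j : ℝ) + 1) * j.factorial := by
        rw [Nat.cast_zero, zero_add, Real.Gamma_nat_eq_factorial, Nat.factorial_succ]
        push_cast; ring
      rw [e1, show j + 1 - j - 1 = 0 by omega]
      push_cast
      simp
      field_simp
    · obtain ⟨m, rfl⟩ : ∃ m, j = m + n := ⟨j - n, by omega⟩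
      rw [show m + n + 1 = (m + 1) + n by ring, shiftSeq_add, weberCoeff_add, weberCoeff_add,
        show n + (m + 1) = (n + m) + 1 by ring, digammaSucc_succ, digammaSucc_succ]
      unfold eulerSeq besselCoeff
      have e1 : Real.Gamma (((m + 1 : ℕ) : ℝ) + (n : ℝ) + 1) =
          ((n : ℝ) + m + 1) * (n + m).factorial := by
        rw [show ((m + 1 : ℕ) : ℝ) + (n : ℝ) = ((n + m + 1 : ℕ) : ℝ) by push_cast; ring,
          Real.Gamma_nat_eq_factorial, Nat.factorial_succ]
        push_cast; ring
      rw [e1, Nat.factorial_succ, Nat.factorial_succ, pow_succ]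
      push_cast
      have h1 : (n : ℝ) + m + 1 ≠ 0 := by positivity
      have h2 : (m : ℝ) + 1 ≠ 0 := by positivity
      generalize digammaSucc m = A
      generalize digammaSucc (n + m) = B
      field_simp
      ring

lemma frobenius_eq_shiftSeq {g : ℕ → ℝ} (hg : Entire g) (n : ℕ) {t : ℝ} (ht : 0 < t) :
    frobenius n g t = frobenius (-n) (shiftSeq n g) t := by
  unfold frobenius
  have ht2 : 0 < t / 2 := by positivity
  rw [seriesSum_shiftSeq hg, Real.rpow_neg ht2.le, Real.rpow_natCast, ← pow_mul, mul_comm 2 n,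
    pow_mul]
  field_simp

lemma hasDerivAt_log_half {t : ℝ} (ht : 0 < t) :
    HasDerivAt (fun t => Real.log (t / 2)) (1 / t) t := by
  refine (((hasDerivAt_id t).div_const 2).log (by simpa using ht.ne')).congr_deriv ?_
  simp only [id]
  field_simp

lemma isBesselPair_besselYNat (n : ℕ) :
    IsBesselPair n (besselYNat n) (fun t =>
      2 / Real.pi * (1 / t * besselJ n t + Real.log (t / 2) *
        (frobenius n (eulerSeq n (besselCoeff n)) t / t)) +
      frobenius (-n) (eulerSeq (-n) (weberCoeff n)) t / t) := by
  have hJ : IsBesselPair n (besselJ n)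
      (fun t => frobenius n (eulerSeq n (besselCoeff n)) t / t) :=
    isBesselPair_besselJ rfl fun k => by positivity
  have hb := entire_weberCoeff n
  refine IsBesselPair.congr
    (f := fun t => 2 / Real.pi * (Real.log (t / 2) * besselJ n t) +
      frobenius (-n) (weberCoeff n) t) ⟨fun t ht => ?_, fun t ht => ?_⟩
    fun t ht => besselYNat_eq n ht
  · exact (((hasDerivAt_log_half ht).mul (hJ.hasDerivAt t ht)).const_mul _).add
      (hasDerivAt_frobenius_eulerSeq hb _ ht)
  · have h1 : HasDerivAt (fun t : ℝ => 1 / t) (-1 / t ^ 2) t := by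
      simpa [neg_div] using hasDerivAt_inv ht.ne'
    refine ((((h1.mul (hJ.hasDerivAt t ht)).add
      ((hasDerivAt_log_half ht).mul (hJ.hasDerivAt' t ht))).const_mul (2 / Real.pi)).add
      (hasDerivAt_frobenius_deriv (s := -n) hb ht)).congr_deriv ?_
    have e := frobenius_ode (s := -n) hb (weberCoeff_ode n) t
    have e2 : frobenius (-n) (fun k => -(4 / Real.pi) *
        shiftSeq n (eulerSeq n (besselCoeff n)) k) t =
        -(4 / Real.pi) * frobenius n (eulerSeq n (besselCoeff n)) t := by
      rw [frobenius_eq_shiftSeq ((entire_besselCoeff n).eulerSeq n) n ht]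
      unfold frobenius
      rw [seriesSum_const_mul]
      ring
    rw [e2] at e
    generalize frobenius n (eulerSeq n (besselCoeff n)) t = J' at *
    generalize besselJ n t = J at *
    generalize frobenius (-n) (eulerSeq (-n) (eulerSeq (-n) (weberCoeff n))) t = B2 at *
    generalize frobenius (-n) (eulerSeq (-n) (weberCoeff n)) t = B1 at *
    generalize frobenius (-n) (weberCoeff n) t = B0 at *
    have hπ := Real.pi_ne_zero
    field_simp at e ⊢
    linear_combination e

lemma wronskian_besselYNat_ne_zero (n : ℕ) :
    ∃ f' g', IsBesselPair n (besselJ n) f' ∧ IsBesselPair n (besselYNat n) g' ∧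
      ∀ t > 0, besselJ n t * g' t - f' t * besselYNat n t ≠ 0 := by
  have hJ : IsBesselPair n (besselJ n)
      (fun t => frobenius n (eulerSeq n (besselCoeff n)) t / t) :=
    isBesselPair_besselJ rfl fun k => by positivity
  refine ⟨_, _, hJ, isBesselPair_besselYNat n, fun t ht h0 => ?_⟩
  set a := besselCoeff n with ha
  have ea : Entire a := entire_besselCoeff n
  have a0 : a 0 ≠ 0 := by
    simp [ha, besselCoeff, Real.Gamma_nat_eq_factorial, Nat.factorial_ne_zero]
  -- The limit of `t` times the Wronskian at `0`: the logarithms cancel and leave `(2/π) J_n²` plus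
  -- the Frobenius contribution. The first term survives only for `n = 0`, where `0 ^ 0 = 1`, the
  -- second only for `n ≥ 1`.
  set c : ℝ := 2 / Real.pi * ((0 : ℝ) ^ n * a 0) ^ 2 + -2 * (n : ℝ) * a 0 * weberCoeff n 0 with hc
  have hc0 : c ≠ 0 := by
    rcases Nat.eq_zero_or_pos n with h | h
    · subst h
      have : c = 2 / Real.pi * a 0 ^ 2 := by simp [hc]
      rw [this]
      positivity
    · have : c = -2 * (n : ℝ) * a 0 * weberCoeff n 0 := by simp [hc, h.ne']
      rw [this]
      have hb : weberCoeff n 0 ≠ 0 := by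
        simp [weberCoeff, h, Real.pi_ne_zero, Nat.factorial_ne_zero]
      have : (n : ℝ) ≠ 0 := by exact_mod_cast h.ne'
      simp [a0, hb, this]
  refine hc0 ((hJ.wronskian (isBesselPair_besselYNat n) ?_ ht).symm.trans
    (mul_eq_zero_of_right t h0))
  have h1 := tendsto_frobenius_wronskian ea (entire_weberCoeff n) n
  have h2 : Tendsto (fun t : ℝ => 2 / Real.pi * ((t / 2) ^ n * seriesSum a ((t / 2) ^ 2)) ^ 2)
      (𝓝[>] 0) (𝓝 (2 / Real.pi * ((0 : ℝ) ^ n * a 0) ^ 2)) := by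
    have hS := continuous_seriesSum ea
    have hcont : Continuous fun t : ℝ =>
        2 / Real.pi * ((t / 2) ^ n * seriesSum a ((t / 2) ^ 2)) ^ 2 := by fun_prop
    have := hcont.tendsto 0
    simp only [zero_div, ne_eq, OfNat.ofNat_ne_zero, not_false_eq_true, zero_pow,
      seriesSum_zero] at this
    exact this.mono_left nhdsWithin_le_nhds
  refine (h2.add h1).congr' ?_
  filter_upwards [self_mem_nhdsWithin] with s hs
  have hs0 : (0 : ℝ) < s := hs
  rw [besselYNat_eq n hs0, besselJ_eq_frobenius n hs0, ← ha]
  have e : (s / 2) ^ n * seriesSum a ((s / 2) ^ 2) = frobenius n a s := by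
    simp [frobenius]
  rw [e]
  field_simp
  ring

/-! ### Independence of the two solutions for every order -/

lemma sin_pi_mul_ne_zero {ν : ℝ} (h0 : 0 ≤ ν) (h : ¬ (⌊ν⌋₊ : ℝ) = ν) :
    Real.sin (Real.pi * ν) ≠ 0 := by
  intro hs
  obtain ⟨m, hm⟩ := Real.sin_eq_zero_iff.1 hs
  have hmν : (m : ℝ) = ν := by
    have := Real.pi_ne_zero
    rw [mul_comm] at hm
    exact mul_left_cancel₀ this hm
  have hm0 : 0 ≤ m := by exact_mod_cast hmν ▸ h0
  lift m to ℕ using hm0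
  apply h
  rw [← hmν]
  simp

lemma wronskian_besselJ_neg_ne_zero {ν : ℝ} (h0 : 0 ≤ ν) (h : ¬ (⌊ν⌋₊ : ℝ) = ν) :
    ∃ f' g', IsBesselPair ν (besselJ ν) f' ∧ IsBesselPair ν (besselJ (-ν)) g' ∧
      ∀ t > 0, besselJ ν t * g' t - f' t * besselJ (-ν) t ≠ 0 := by
  have hν0 : ν ≠ 0 := by rintro rfl; simp at h
  have hnat : ∀ k : ℕ, (k : ℝ) ≠ ν := by
    rintro k rfl; simp at h
  have hJ := isBesselPair_besselJ (ν := ν) rfl fun k => by positivity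
  have hJn := isBesselPair_besselJ (ν := -ν) (μ := ν) (by ring) fun k hk => hnat (k + 1) (by
    push_cast; linarith)
  refine ⟨_, _, hJ, hJn, fun t ht hw => ?_⟩
  have hc0 : -2 * ν * besselCoeff ν 0 * besselCoeff (-ν) 0 ≠ 0 := by
    have h1 : Real.Gamma (ν + 1) ≠ 0 := (Real.Gamma_pos_of_pos (by linarith)).ne'
    have h2 : Real.Gamma (-ν + 1) ≠ 0 := Real.Gamma_ne_zero fun m hm =>
      hnat (m + 1) (by push_cast; linarith)
    simp [besselCoeff, h1, h2, hν0]
  refine hc0 ((hJ.wronskian hJn ?_ ht).symm.trans (mul_eq_zero_of_right t hw))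
  refine (tendsto_frobenius_wronskian (entire_besselCoeff ν) (entire_besselCoeff (-ν)) ν).congr' ?_
  filter_upwards [self_mem_nhdsWithin] with s hs
  have hs0 : (0 : ℝ) < s := hs
  rw [besselJ_eq_frobenius ν hs0, besselJ_eq_frobenius (-ν) hs0]

/-- For non-integer `ν`, `Y_ν` is a combination of `J_ν` and `J_{-ν}` with coefficient `-1 /
sin(πν)` on the latter, so independence carries over from that pair. -/
theorem exists_besselPair {ν : ℝ} (h0 : 0 ≤ ν) :
    ∃ f' g', IsBesselPair ν (besselJ ν) f' ∧ IsBesselPair ν (besselY ν) g' ∧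
      ∀ t > 0, besselJ ν t * g' t - f' t * besselY ν t ≠ 0 := by
  by_cases h : (⌊ν⌋₊ : ℝ) = ν
  · have e : besselY ν = besselYNat ⌊ν⌋₊ := by
      funext x; rw [besselY, if_pos h]
    have := wronskian_besselYNat_ne_zero ⌊ν⌋₊
    rw [e]
    rwa [h] at this
  · have hs := sin_pi_mul_ne_zero h0 h
    obtain ⟨f', g', hf, hg, hw⟩ := wronskian_besselJ_neg_ne_zero h0 h
    have hY := (hf.linear_comb hg (Real.cos (Real.pi * ν) / Real.sin (Real.pi * ν))
      (-1 / Real.sin (Real.pi * ν))).congr (g := besselY ν)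
      fun t _ => by rw [besselY, if_neg h]; ring
    refine ⟨_, _, hf, hY, fun t ht hz => hw t ht ?_⟩
    rw [besselY, if_neg h] at hz
    field_simp at hz
    linear_combination -hz

/-! ### The differential equation after multiplication by a power -/

/-- `u` solves `u'' + (2δ+1)/t u' + (1 - (ν² - δ²)/t²) u = 0` on `(0, ∞)`. -/
structure IsUltraSolution (ν δ : ℝ) (u : ℝ → ℝ) : Prop where
  hasDerivAt : ∀ t > 0, HasDerivAt u (deriv u t) t
  hasDerivAt_deriv : ∀ t > 0, HasDerivAt (deriv u)
    (-(2 * δ + 1) / t * deriv u t - (1 - (ν ^ 2 - δ ^ 2) / t ^ 2) * u t) t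

lemma IsBesselPair.hasDerivAt_rpow_mul {ν : ℝ} {f f' : ℝ → ℝ} (hf : IsBesselPair ν f f') (δ : ℝ)
    {t : ℝ} (ht : 0 < t) :
    HasDerivAt (fun t => t ^ (-δ) * f t) (t ^ (-δ) * (f' t - δ * f t / t)) t := by
  refine ((Real.hasDerivAt_rpow_const (Or.inl ht.ne')).mul (hf.hasDerivAt t ht)).congr_deriv ?_
  rw [Real.rpow_sub_one ht.ne']
  field_simp
  ring

lemma IsBesselPair.isUltraSolution {ν : ℝ} {f f' : ℝ → ℝ} (hf : IsBesselPair ν f f') (δ : ℝ) :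
    IsUltraSolution ν δ (fun t => t ^ (-δ) * f t) where
  hasDerivAt t ht := (hf.hasDerivAt_rpow_mul δ ht).differentiableAt.hasDerivAt
  hasDerivAt_deriv t ht := by
    have hd : ∀ s > 0, deriv (fun t => t ^ (-δ) * f t) s = s ^ (-δ) * (f' s - δ * f s / s) :=
      fun s hs => (hf.hasDerivAt_rpow_mul δ hs).deriv
    have he : deriv (fun t => t ^ (-δ) * f t) =ᶠ[𝓝 t]
        fun s => s ^ (-δ) * (f' s - δ * f s / s) := by
      filter_upwards [Ioi_mem_nhds ht] with s hs using hd s hs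
    refine HasDerivAt.congr_of_eventuallyEq ?_ he
    rw [hd t ht]
    refine ((Real.hasDerivAt_rpow_const (Or.inl ht.ne')).mul ((hf.hasDerivAt' t ht).sub
      (((hf.hasDerivAt t ht).const_mul δ).div (hasDerivAt_id t) ht.ne'))).congr_deriv ?_
    rw [Real.rpow_sub_one ht.ne']
    simp only [id, Pi.sub_apply, Pi.div_apply]
    field_simp
    ring

theorem ultra_solutions {ν : ℝ} (h0 : 0 ≤ ν) (δ : ℝ) :
    IsUltraSolution ν δ (ultraJ ν δ) ∧ IsUltraSolution ν δ (ultraY ν δ) ∧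
      ∀ t > 0, ultraJ ν δ t * deriv (ultraY ν δ) t - deriv (ultraJ ν δ) t * ultraY ν δ t ≠ 0 := by
  obtain ⟨f', g', hf, hg, hw⟩ := exists_besselPair h0
  refine ⟨hf.isUltraSolution δ, hg.isUltraSolution δ, fun t ht h => hw t ht ?_⟩
  have e1 : deriv (ultraJ ν δ) t = _ := (hf.hasDerivAt_rpow_mul δ ht).deriv
  have e2 : deriv (ultraY ν δ) t = _ := (hg.hasDerivAt_rpow_mul δ ht).deriv
  rw [e1, e2] at h
  unfold ultraJ ultraY at h
  have hp : t ^ (-δ) ≠ 0 := (Real.rpow_pos_of_pos ht _).ne'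
  refine (mul_eq_zero.1 (?_ : (t ^ (-δ)) ^ 2 * _ = 0)).resolve_left (pow_ne_zero 2 hp)
  rw [← h]
  ring

/-! ### The phase equation and comparison of its solutions -/

/-- The right-hand side of the Prüfer phase equation
`θ' = x - μ / (x ρ²) cos² θ - (κ / ρ) sin 2θ`. -/
noncomputable def phaseField (μ κ x ρ θ : ℝ) : ℝ :=
  x - μ / (x * ρ ^ 2) * Real.cos θ ^ 2 - κ / ρ * Real.sin (2 * θ)

/-- The difference quotient of `phaseField` in the phase variable. -/
noncomputable def phaseSlope (μ κ x ρ a b : ℝ) : ℝ :=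
  Real.sinc (b - a) * (μ / (x * ρ ^ 2) * Real.sin (a + b) - 2 * (κ / ρ) * Real.cos (a + b))

lemma sinc_mul_self (x : ℝ) : Real.sinc x * x = Real.sin x := by
  by_cases h : x = 0
  · simp [h]
  · rw [Real.sinc_of_ne_zero h]; field_simp

/-- Makes the difference of two phases satisfy a linear equation; `Real.sinc` keeps the slope
continuous where the phases meet. -/
lemma phaseField_sub (μ κ x ρ a b : ℝ) :
    phaseField μ κ x ρ b - phaseField μ κ x ρ a = phaseSlope μ κ x ρ a b * (b - a) := by
  have e1 : Real.cos a ^ 2 - Real.cos b ^ 2 = Real.sin (b - a) * Real.sin (a + b) := by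
    rw [Real.sin_sub, Real.sin_add]
    linear_combination -(Real.cos a ^ 2) * Real.sin_sq_add_cos_sq b
      + (Real.cos b ^ 2) * Real.sin_sq_add_cos_sq a
  have e2 : Real.sin (2 * b) - Real.sin (2 * a) = 2 * Real.sin (b - a) * Real.cos (a + b) := by
    rw [Real.sin_sub_sin, show (2 * b - 2 * a) / 2 = b - a by ring,
      show (2 * b + 2 * a) / 2 = a + b by ring]
  unfold phaseField phaseSlope
  rw [mul_right_comm, sinc_mul_self]
  linear_combination μ / (x * ρ ^ 2) * e1 - κ / ρ * e2

/-- Positivity for a scalar linear differential inequality `D' > m D`. -/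
lemma pos_of_linear_deriv {D m D' : ℝ → ℝ} {r R : ℝ} (hr : 0 < r) (hrR : r < R)
    (hm : ContinuousOn m (Set.Ioi 0)) (hD : ∀ ρ > 0, HasDerivAt D (D' ρ) ρ)
    (hg : ∀ ρ ∈ Set.Ioo r R, m ρ * D ρ < D' ρ) (h0 : 0 ≤ D r) : 0 < D R := by
  -- Integrating factor: `D exp(-M)` has positive derivative on the open interval.
  set M : ℝ → ℝ := fun ρ => ∫ s in r..ρ, m s with hM
  have hM' : ∀ ρ > 0, HasDerivAt M (m ρ) ρ := by
    intro ρ hρ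
    refine intervalIntegral.integral_hasDerivAt_right ?_ ?_ (hm.continuousAt (Ioi_mem_nhds hρ))
    · refine (hm.mono ?_).intervalIntegrable
      intro s hs
      exact (lt_min hr hρ).trans_le hs.1
    · exact hm.stronglyMeasurableAtFilter isOpen_Ioi ρ hρ
  have hE : ∀ ρ > 0, HasDerivAt (fun ρ => D ρ * Real.exp (-M ρ))
      ((D' ρ - m ρ * D ρ) * Real.exp (-M ρ)) ρ := by
    intro ρ hρ
    refine ((hD ρ hρ).mul (hM' ρ hρ).neg.exp).congr_deriv ?_
    rw [Pi.neg_apply]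
    ring
  have hmono : StrictMonoOn (fun ρ => D ρ * Real.exp (-M ρ)) (Set.Icc r R) := by
    refine strictMonoOn_of_deriv_pos (convex_Icc r R) ?_ ?_
    · intro ρ hρ
      exact (hE ρ (hr.trans_le hρ.1)).continuousAt.continuousWithinAt
    · intro ρ hρ
      rw [interior_Icc] at hρ
      rw [(hE ρ (hr.trans hρ.1)).deriv]
      exact mul_pos (sub_pos.2 (hg ρ hρ)) (Real.exp_pos _)
  have h1 := hmono (Set.left_mem_Icc.2 hrR.le) (Set.right_mem_Icc.2 hrR.le) hrR
  have h2 : 0 ≤ D r * Real.exp (-M r) := mul_nonneg h0 (Real.exp_pos _).le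
  exact pos_of_mul_pos_left (h2.trans_lt h1) (Real.exp_pos _).le

/-- Comparison of a sub- and a supersolution of the phase equation. -/
lemma phase_comparison {μ κ x r R : ℝ} {a b a' b' : ℝ → ℝ} (hx : 0 < x) (hr : 0 < r) (hrR : r < R)
    (ha : ∀ ρ > 0, HasDerivAt a (a' ρ) ρ) (hb : ∀ ρ > 0, HasDerivAt b (b' ρ) ρ)
    (hab : ∀ ρ ∈ Set.Ioo r R,
      a' ρ - phaseField μ κ x ρ (a ρ) < b' ρ - phaseField μ κ x ρ (b ρ))
    (h0 : a r ≤ b r) : a R < b R := by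
  have hca : ContinuousOn a (Set.Ioi 0) := fun ρ hρ => (ha ρ hρ).continuousAt.continuousWithinAt
  have hcb : ContinuousOn b (Set.Ioi 0) := fun ρ hρ => (hb ρ hρ).continuousAt.continuousWithinAt
  have hm : ContinuousOn (fun ρ => phaseSlope μ κ x ρ (a ρ) (b ρ)) (Set.Ioi 0) := by
    unfold phaseSlope
    refine ContinuousOn.mul (Real.continuous_sinc.comp_continuousOn (hcb.sub hca))
      (ContinuousOn.sub (ContinuousOn.mul (ContinuousOn.div (by fun_prop) (by fun_prop) ?_)
        (Real.continuous_sin.comp_continuousOn (hca.add hcb)))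
      (ContinuousOn.mul (ContinuousOn.mul (by fun_prop) (ContinuousOn.div (by fun_prop)
        (by fun_prop) ?_)) (Real.continuous_cos.comp_continuousOn (hca.add hcb))))
    · intro ρ hρ
      have : (0 : ℝ) < ρ := hρ
      positivity
    · intro ρ hρ
      exact ne_of_gt hρ
  have := pos_of_linear_deriv (D := fun ρ => b ρ - a ρ) (D' := fun ρ => b' ρ - a' ρ) hr hrR hm
    (fun ρ hρ => (hb ρ hρ).sub (ha ρ hρ)) (fun ρ hρ => ?_) (sub_nonneg.2 h0)
  · exact sub_pos.1 this
  · have h1 := hab ρ hρ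
    have h2 := phaseField_sub μ κ x ρ (a ρ) (b ρ)
    linarith

lemma abs_phaseSlope_le {μ κ x ρ r : ℝ} (hμ : 0 ≤ μ) (hx : 0 < x) (hr : 0 < r) (hρ : r ≤ ρ)
    (a b : ℝ) : |phaseSlope μ κ x ρ a b| ≤ μ / (x * r ^ 2) + 2 * (|κ| / r) := by
  have hρ0 : 0 < ρ := hr.trans_le hρ
  unfold phaseSlope
  rw [abs_mul]
  have h1 : |Real.sinc (b - a)| ≤ 1 := Real.abs_sinc_le_one _
  have h2 : |μ / (x * ρ ^ 2) * Real.sin (a + b) - 2 * (κ / ρ) * Real.cos (a + b)| ≤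
      μ / (x * r ^ 2) + 2 * (|κ| / r) := by
    refine (abs_sub _ _).trans (add_le_add ?_ ?_)
    · rw [abs_mul, abs_of_nonneg (by positivity : 0 ≤ μ / (x * ρ ^ 2))]
      calc μ / (x * ρ ^ 2) * |Real.sin (a + b)| ≤ μ / (x * ρ ^ 2) * 1 := by
            gcongr; exact Real.abs_sin_le_one _
        _ ≤ μ / (x * r ^ 2) := by rw [mul_one]; gcongr
    · rw [abs_mul, abs_mul, abs_div, abs_of_pos hρ0, abs_two]
      calc 2 * (|κ| / ρ) * |Real.cos (a + b)| ≤ 2 * (|κ| / ρ) * 1 := by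
            gcongr; exact Real.abs_cos_le_one _
        _ ≤ 2 * (|κ| / r) := by rw [mul_one]; gcongr
  calc _ ≤ 1 * (μ / (x * r ^ 2) + 2 * (|κ| / r)) := by gcongr
    _ = _ := one_mul _

/-! ### The phase at `R` as a function of `x` -/

/-- The solutions of the phase equation with initial value `0` at `r`. -/
structure IsPhase (μ κ r : ℝ) (θ : ℝ → ℝ → ℝ) : Prop where
  init : ∀ x > 0, θ x r = 0
  deriv : ∀ x > 0, ∀ ρ > 0, HasDerivAt (θ x) (phaseField μ κ x ρ (θ x ρ)) ρ

section Phase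

variable {μ κ r R : ℝ} {θ : ℝ → ℝ → ℝ}

/-- Since `μ ≥ 0`, the field increases strictly with `x`, so the phase for a smaller `x` is a strict
subsolution for a larger one. -/
lemma IsPhase.strictMonoOn (h : IsPhase μ κ r θ) (hμ : 0 ≤ μ) (hr : 0 < r) (hrR : r < R) :
    StrictMonoOn (fun x => θ x R) (Set.Ioi 0) := by
  intro x hx y hy hxy
  have hx0 : 0 < x := hx
  have hy0 : 0 < y := hy
  refine phase_comparison (μ := μ) (κ := κ) hy hr hrR (h.deriv x hx) (h.deriv y hy) (fun ρ hρ => ?_)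
    (by rw [h.init x hx, h.init y hy])
  have hρ0 : 0 < ρ := hr.trans hρ.1
  rw [sub_self]
  unfold phaseField
  have : μ / (y * ρ ^ 2) * Real.cos (θ x ρ) ^ 2 ≤ μ / (x * ρ ^ 2) * Real.cos (θ x ρ) ^ 2 := by
    gcongr
  linarith

/-- At `θ = -π/2` both `cos θ` and `sin 2θ` vanish and the field is `x > 0`, so this constant is a
strict subsolution. The bound excludes all negative multiples of `π`. -/
lemma IsPhase.neg_pi_lt (h : IsPhase μ κ r θ) (hr : 0 < r) (hrR : r < R) {x : ℝ} (hx : 0 < x) :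
    -Real.pi < θ x R := by
  have : -(Real.pi / 2) < θ x R := by
    refine phase_comparison (μ := μ) (κ := κ) (a := fun _ => -(Real.pi / 2)) (a' := fun _ => 0)
      hx hr hrR (fun ρ _ => hasDerivAt_const ρ _) (h.deriv x hx) (fun ρ hρ => ?_) ?_
    · rw [sub_self]
      unfold phaseField
      rw [Real.cos_neg, Real.cos_pi_div_two, show 2 * (-(Real.pi / 2)) = -Real.pi by ring]
      simpa using hx
    · rw [h.init x hx]
      linarith [Real.pi_pos]
  linarith [Real.pi_pos]

lemma IsPhase.pos (h : IsPhase 0 κ r θ) (hr : 0 < r) (hrR : r < R) {x : ℝ} (hx : 0 < x) :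
    0 < θ x R := by
  refine phase_comparison (μ := 0) (κ := κ) (a := fun _ => 0) (a' := fun _ => 0)
    hx hr hrR (fun ρ _ => hasDerivAt_const ρ _) (h.deriv x hx) (fun ρ hρ => ?_) ?_
  · rw [sub_self]
    simpa [phaseField] using hx
  · rw [h.init x hx]

/-- At `θ = 0` the field is `x - μ/(xρ²)`. With `x = √μ / R` this is negative for `ρ < R` and zero
at `R`, so the zero phase is a strict supersolution on the open interval. -/
lemma IsPhase.exists_neg (h : IsPhase μ κ r θ) (hμ : 0 < μ) (hr : 0 < r) (hrR : r < R) :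
    ∃ x > 0, θ x R < 0 := by
  have hR : 0 < R := hr.trans hrR
  set x := Real.sqrt μ / R with hxdef
  have hx : 0 < x := by positivity
  refine ⟨x, hx, ?_⟩
  refine phase_comparison (μ := μ) (κ := κ) (b := fun _ => 0) (b' := fun _ => 0)
    hx hr hrR (h.deriv x hx) (fun ρ _ => hasDerivAt_const ρ _) (fun ρ hρ => ?_) ?_
  · have hρ0 : 0 < ρ := hr.trans hρ.1
    rw [sub_self]
    simp only [phaseField, Real.cos_zero, mul_zero, Real.sin_zero]
    have : x < μ / (x * ρ ^ 2) := by
      rw [lt_div_iff₀ (by positivity)]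
      have e : x ^ 2 * R ^ 2 = μ := by
        rw [hxdef, div_pow, Real.sq_sqrt hμ.le]; field_simp
      have : ρ ^ 2 < R ^ 2 := by have := hρ.2; gcongr
      nlinarith [mul_lt_mul_of_pos_left this (pow_pos hx 2)]
    linarith
  · rw [h.init x hx]

lemma tendsto_gronwallBound_zero {ι : Type*} {l : Filter ι} {ε : ι → ℝ} (K d : ℝ)
    (hε : Tendsto ε l (𝓝 0)) : Tendsto (fun i => gronwallBound 0 K (ε i) d) l (𝓝 0) := by
  have := ((gronwallBound_continuous_ε 0 K d).tendsto 0).comp hε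
  simpa [gronwallBound_ε0, Function.comp_def] using this

/-- At `θ = 0` the field is `x`, so by Gronwall the phase is bounded by a quantity that vanishes as
`x → 0`. -/
lemma IsPhase.exists_lt_pi (h : IsPhase 0 κ r θ) (hr : 0 < r) (hrR : r < R) :
    ∃ x > 0, θ x R < Real.pi := by
  have hb : ∀ x > 0, ‖θ x R‖ ≤ gronwallBound 0 (2 * (|κ| / r)) x (R - r) := by
    intro x hx
    refine norm_le_gronwallBound_of_norm_deriv_right_le (a := r) (b := R) (f := θ x)
      (f' := fun ρ => phaseField 0 κ x ρ (θ x ρ))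
      (fun ρ hρ => (h.deriv x hx ρ (hr.trans_le hρ.1)).continuousAt.continuousWithinAt)
      (fun ρ hρ => (h.deriv x hx ρ (hr.trans_le hρ.1)).hasDerivWithinAt)
      (by simp [h.init x hx]) (fun ρ hρ => ?_) R (Set.right_mem_Icc.2 hrR.le)
    have e := phaseField_sub 0 κ x ρ 0 (θ x ρ)
    have e0 : phaseField 0 κ x ρ 0 = x := by simp [phaseField]
    have e1 := abs_phaseSlope_le (μ := 0) (κ := κ) le_rfl hx hr hρ.1 0 (θ x ρ)
    rw [e0, sub_zero] at e
    rw [eq_add_of_sub_eq e]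
    refine (norm_add_le _ _).trans ?_
    rw [norm_mul, Real.norm_of_nonneg hx.le]
    gcongr
    simpa using e1
  have ht : Tendsto (fun x => gronwallBound 0 (2 * (|κ| / r)) x (R - r)) (𝓝[>] 0) (𝓝 0) :=
    tendsto_gronwallBound_zero _ _ (tendsto_id.mono_left nhdsWithin_le_nhds)
  obtain ⟨x, hx, hx0⟩ := ((ht.eventually (gt_mem_nhds Real.pi_pos)).and
    self_mem_nhdsWithin).exists
  exact ⟨x, hx0, ((le_abs_self _).trans (hb x hx0)).trans_lt hx⟩

lemma IsPhase.continuousOn (h : IsPhase μ κ r θ) (hμ : 0 ≤ μ) (hr : 0 < r) (hrR : r < R) :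
    ContinuousOn (fun x => θ x R) (Set.Ioi 0) := by
  intro y hy
  have hy0 : 0 < y := hy
  set K := μ / (y * r ^ 2) + 2 * (|κ| / r)
  -- Bounds the change of the field when `y` is replaced by `x` at the same phase, uniformly for `ρ
  -- ≥ r`.
  set ε : ℝ → ℝ := fun x => |x - y| + |μ / x - μ / y| / r ^ 2 with hεdef
  have hb : ∀ x > 0, ‖θ x R - θ y R‖ ≤ gronwallBound 0 K (ε x) (R - r) := by
    intro x hx
    refine norm_le_gronwallBound_of_norm_deriv_right_le (a := r) (b := R)
      (f := fun ρ => θ x ρ - θ y ρ)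
      (f' := fun ρ => phaseField μ κ x ρ (θ x ρ) - phaseField μ κ y ρ (θ y ρ))
      (fun ρ hρ => ((h.deriv x hx ρ (hr.trans_le hρ.1)).sub
        (h.deriv y hy ρ (hr.trans_le hρ.1))).continuousAt.continuousWithinAt)
      (fun ρ hρ => ((h.deriv x hx ρ (hr.trans_le hρ.1)).sub
        (h.deriv y hy ρ (hr.trans_le hρ.1))).hasDerivWithinAt)
      (by simp [h.init x hx, h.init y hy]) (fun ρ hρ => ?_) R (Set.right_mem_Icc.2 hrR.le)
    have hρ0 : 0 < ρ := hr.trans_le hρ.1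
    have e := phaseField_sub μ κ y ρ (θ y ρ) (θ x ρ)
    have e1 := abs_phaseSlope_le (κ := κ) hμ hy0 hr hρ.1 (θ y ρ) (θ x ρ)
    have e2 : phaseField μ κ x ρ (θ x ρ) - phaseField μ κ y ρ (θ x ρ) =
        (x - y) - (μ / x - μ / y) / ρ ^ 2 * Real.cos (θ x ρ) ^ 2 := by
      unfold phaseField
      field_simp
      ring
    have e3 : |phaseField μ κ x ρ (θ x ρ) - phaseField μ κ y ρ (θ x ρ)| ≤ ε x := by
      rw [e2]
      refine (abs_sub _ _).trans ?_
      rw [hεdef]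
      refine add_le_add le_rfl ?_
      rw [abs_mul, abs_div, abs_of_nonneg (sq_nonneg (Real.cos _)), abs_of_pos (pow_pos hρ0 2)]
      calc |μ / x - μ / y| / ρ ^ 2 * Real.cos (θ x ρ) ^ 2 ≤ |μ / x - μ / y| / ρ ^ 2 * 1 := by
            gcongr; exact Real.cos_sq_le_one _
        _ ≤ _ := by rw [mul_one]; have := hρ.1; gcongr
    rw [show phaseField μ κ x ρ (θ x ρ) - phaseField μ κ y ρ (θ y ρ) =
      phaseSlope μ κ y ρ (θ y ρ) (θ x ρ) * (θ x ρ - θ y ρ) +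
      (phaseField μ κ x ρ (θ x ρ) - phaseField μ κ y ρ (θ x ρ)) by rw [← e]; ring]
    refine (norm_add_le _ _).trans (add_le_add ?_ e3)
    rw [norm_mul]
    gcongr
    exact e1
  have hε : Tendsto ε (𝓝[Set.Ioi 0] y) (𝓝 0) := by
    have hc : ContinuousAt ε y := by
      rw [hεdef]
      have := hy0.ne'
      fun_prop (disch := assumption)
    have h0 : ε y = 0 := by simp [hεdef]
    rw [← h0]
    exact hc.tendsto.mono_left nhdsWithin_le_nhds
  refine tendsto_iff_norm_sub_tendsto_zero.2 ?_
  refine squeeze_zero' (Eventually.of_forall fun _ => norm_nonneg _) ?_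
    (tendsto_gronwallBound_zero K (R - r) hε)
  filter_upwards [self_mem_nhdsWithin] with x hx using hb x hx

/-- The phase at `R` is `(R - r) x + O(1/x)`. -/
lemma IsPhase.asymptotic (h : IsPhase μ κ r θ) (hμ : 0 ≤ μ) (hr : 0 < r) (hrR : r < R) :
    ∃ C : ℝ, 0 ≤ C ∧ ∀ x ≥ 1, |θ x R - (R - r) * x| ≤ C / x := by
  -- For `x ≥ 1`, `B` bounds `|θ' - x|`, and `A / x` will bound the derivative of the corrected
  -- phase `E`.
  set B : ℝ := μ / r ^ 2 + |κ| / r with hB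
  set A : ℝ := μ / r ^ 2 + |κ| / (2 * r ^ 2) + |κ| / r * B with hA
  refine ⟨A * (R - r) + |κ| / r, by have := sub_pos.2 hrR; positivity, fun x hx => ?_⟩
  have hx0 : 0 < x := by linarith
  -- Averaging: since `θ' ≈ x`, the term `-(κ/ρ) sin 2θ` is nearly the derivative of `κ cos 2θ /
  -- (2xρ)`. Subtracting that cancels it and leaves a derivative of order `1/x`.
  set E : ℝ → ℝ := fun ρ => θ x ρ - x * ρ - κ / (2 * x) * (ρ⁻¹ * Real.cos (2 * θ x ρ)) with hE
  set E' : ℝ → ℝ := fun ρ => phaseField μ κ x ρ (θ x ρ) - x - κ / (2 * x) *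
    (-(ρ ^ 2)⁻¹ * Real.cos (2 * θ x ρ) +
      ρ⁻¹ * (-Real.sin (2 * θ x ρ) * (2 * phaseField μ κ x ρ (θ x ρ)))) with hE'
  have hder : ∀ ρ > 0, HasDerivAt E (E' ρ) ρ := by
    intro ρ hρ
    have h1 := h.deriv x hx0 ρ hρ
    have h2 := (hasDerivAt_inv hρ.ne').mul (h1.const_mul 2).cos
    have h3 := (h1.sub ((hasDerivAt_id ρ).const_mul x)).sub (h2.const_mul (κ / (2 * x)))
    refine h3.congr_deriv ?_
    rw [hE', mul_one]
  have hbound : ∀ ρ ≥ r, |E' ρ| ≤ A / x := by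
    intro ρ hρ
    have hρ0 : 0 < ρ := hr.trans_le hρ
    set F := phaseField μ κ x ρ (θ x ρ) with hF
    have c1 : |μ / (x * ρ ^ 2) * Real.cos (θ x ρ) ^ 2| ≤ μ / r ^ 2 / x := by
      rw [abs_of_nonneg (by positivity)]
      calc _ ≤ μ / (x * ρ ^ 2) * 1 := by gcongr; exact Real.cos_sq_le_one _
        _ = μ / ρ ^ 2 / x := by rw [mul_one]; field_simp
        _ ≤ _ := by gcongr
    have c2 : |κ / ρ * Real.sin (2 * θ x ρ)| ≤ |κ| / r := by
      rw [abs_mul, abs_div, abs_of_pos hρ0]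
      calc _ ≤ |κ| / ρ * 1 := by gcongr; exact Real.abs_sin_le_one _
        _ ≤ _ := by rw [mul_one]; gcongr
    have c3 : |F - x| ≤ B := by
      have : F - x = -(μ / (x * ρ ^ 2) * Real.cos (θ x ρ) ^ 2) -
        κ / ρ * Real.sin (2 * θ x ρ) := by rw [hF]; unfold phaseField; ring
      rw [this]
      refine (abs_sub _ _).trans (add_le_add ?_ c2)
      rw [abs_neg]
      exact c1.trans (div_le_self (by positivity) hx)
    have c4 : |κ / (2 * x * ρ ^ 2) * Real.cos (2 * θ x ρ)| ≤ |κ| / (2 * r ^ 2) / x := by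
      rw [abs_mul, abs_div, abs_of_pos (by positivity : 0 < 2 * x * ρ ^ 2)]
      calc _ ≤ |κ| / (2 * x * ρ ^ 2) * 1 := by gcongr; exact Real.abs_cos_le_one _
        _ = |κ| / (2 * ρ ^ 2) / x := by rw [mul_one]; field_simp
        _ ≤ _ := by gcongr
    have c5 : |κ / ρ * Real.sin (2 * θ x ρ) * (F - x) / x| ≤ |κ| / r * B / x := by
      rw [abs_div, abs_mul, abs_of_pos hx0]
      gcongr
    have key : E' ρ = -(μ / (x * ρ ^ 2) * Real.cos (θ x ρ) ^ 2) +
        κ / (2 * x * ρ ^ 2) * Real.cos (2 * θ x ρ) +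
        κ / ρ * Real.sin (2 * θ x ρ) * (F - x) / x := by
      have : F - x = -(μ / (x * ρ ^ 2) * Real.cos (θ x ρ) ^ 2) -
        κ / ρ * Real.sin (2 * θ x ρ) := by rw [hF]; unfold phaseField; ring
      have e : E' ρ = F - x + κ / (2 * x * ρ ^ 2) * Real.cos (2 * θ x ρ) +
        κ / ρ * Real.sin (2 * θ x ρ) * (F - x) / x + κ / ρ * Real.sin (2 * θ x ρ) := by
        simp only [hE']
        field_simp
        ring
      linarith
    rw [key]
    refine (abs_add_three _ _ _).trans ?_
    rw [abs_neg, hA, add_div, add_div]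
    exact add_le_add (add_le_add c1 c4) c5
  have hmv := norm_image_sub_le_of_norm_deriv_le_segment' (f := E) (f' := E') (a := r) (b := R)
    (fun ρ hρ => (hder ρ (hr.trans_le hρ.1)).hasDerivWithinAt)
    (fun ρ hρ => hbound ρ hρ.1) R (Set.right_mem_Icc.2 hrR.le)
  have hcorr : ∀ ρ ≥ r, |κ / (2 * x) * (ρ⁻¹ * Real.cos (2 * θ x ρ))| ≤ |κ| / r / x / 2 := by
    intro ρ hρ
    have hρ0 : 0 < ρ := hr.trans_le hρ
    rw [abs_mul, abs_mul, abs_div, abs_of_pos (inv_pos.2 hρ0), abs_of_pos (by positivity : 0 < 2 * x)]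
    calc _ ≤ |κ| / (2 * x) * (r⁻¹ * 1) := by
          gcongr; exact Real.abs_cos_le_one _
      _ = _ := by field_simp
  have h1 := hcorr r le_rfl
  have h2 := hcorr R hrR.le
  have e : θ x R - (R - r) * x = (E R - E r) + κ / (2 * x) * (R⁻¹ * Real.cos (2 * θ x R)) -
      κ / (2 * x) * (r⁻¹ * Real.cos (2 * θ x r)) := by
    simp only [hE, h.init x hx0]; ring
  rw [e]
  rw [Real.norm_eq_abs] at hmv
  refine (abs_sub _ _).trans ((add_le_add (abs_add_le _ _) le_rfl).trans ?_)
  have e2 : (A * (R - r) + |κ| / r) / x = A / x * (R - r) + |κ| / r / x := by ring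
  rw [e2]
  linarith

end Phase

/-! ### From solutions to phases -/

lemma IsUltraSolution.deriv_linear_comb {ν δ : ℝ} {u v : ℝ → ℝ} (hu : IsUltraSolution ν δ u)
    (hv : IsUltraSolution ν δ v) (a b : ℝ) {t : ℝ} (ht : 0 < t) :
    deriv (fun t => a * u t + b * v t) t = a * deriv u t + b * deriv v t :=
  (((hu.hasDerivAt t ht).const_mul a).add ((hv.hasDerivAt t ht).const_mul b)).deriv

lemma IsUltraSolution.linear_comb {ν δ : ℝ} {u v : ℝ → ℝ} (hu : IsUltraSolution ν δ u)
    (hv : IsUltraSolution ν δ v) (a b : ℝ) :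
    IsUltraSolution ν δ (fun t => a * u t + b * v t) where
  hasDerivAt t ht := by
    rw [hu.deriv_linear_comb hv a b ht]
    exact ((hu.hasDerivAt t ht).const_mul a).add ((hv.hasDerivAt t ht).const_mul b)
  hasDerivAt_deriv t ht := by
    have he : deriv (fun t => a * u t + b * v t) =ᶠ[𝓝 t]
        fun s => a * deriv u s + b * deriv v s := by
      filter_upwards [Ioi_mem_nhds ht] with s hs using hu.deriv_linear_comb hv a b hs
    rw [hu.deriv_linear_comb hv a b ht]
    refine ((((hu.hasDerivAt_deriv t ht).const_mul a).add
      ((hv.hasDerivAt_deriv t ht).const_mul b)).congr_of_eventuallyEq he).congr_deriv ?_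
    ring

/-- The Prüfer phase of a nontrivial solution, normalized to vanish at the Neumann point `r`. -/
theorem IsUltraSolution.exists_phase {ν δ : ℝ} {u : ℝ → ℝ} (hu : IsUltraSolution ν δ u)
    (hne : ∀ t > 0, u t ^ 2 + deriv u t ^ 2 ≠ 0) {x r : ℝ} (hx : 0 < x) (hr : 0 < r)
    (hv : deriv u (x * r) = 0) :
    ∃ θ : ℝ → ℝ, θ r = 0 ∧
      (∀ ρ > 0, HasDerivAt θ (phaseField (ν ^ 2 - δ ^ 2) (δ + 1 / 2) x ρ (θ ρ)) ρ) ∧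
      ∀ ρ > 0, deriv u (x * ρ) = 0 ↔ ∃ k : ℤ, θ ρ = k * Real.pi := by
  set μ := ν ^ 2 - δ ^ 2 with hμ
  set U : ℝ → ℝ := fun ρ => u (x * ρ) with hU
  set V : ℝ → ℝ := fun ρ => deriv u (x * ρ) with hV
  set V' : ℝ → ℝ := fun ρ =>
    -(2 * δ + 1) / (x * ρ) * V ρ - (1 - μ / (x * ρ) ^ 2) * U ρ with hV'
  set N : ℝ → ℝ := fun ρ => U ρ ^ 2 + V ρ ^ 2 with hN
  have hN0 : ∀ ρ > 0, N ρ ≠ 0 := fun ρ hρ => hne _ (mul_pos hx hρ)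
  have hlin : ∀ ρ : ℝ, HasDerivAt (fun ρ => x * ρ) x ρ := fun ρ => by
    simpa using (hasDerivAt_id ρ).const_mul x
  have dU : ∀ ρ > 0, HasDerivAt U (V ρ * x) ρ := fun ρ hρ =>
    (hu.hasDerivAt _ (mul_pos hx hρ)).comp ρ (hlin ρ)
  have dV : ∀ ρ > 0, HasDerivAt V (V' ρ * x) ρ := fun ρ hρ =>
    (hu.hasDerivAt_deriv _ (mul_pos hx hρ)).comp ρ (hlin ρ)
  -- The angular velocity found by differentiating `tan θ = -V/U`. Defining `θ` as its integral
  -- avoids choosing a branch of the angle.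
  set ω : ℝ → ℝ := fun ρ => x * (V ρ ^ 2 - U ρ * V' ρ) / N ρ with hω
  have cU : ContinuousOn U (Set.Ioi 0) := fun ρ hρ => (dU ρ hρ).continuousAt.continuousWithinAt
  have cV : ContinuousOn V (Set.Ioi 0) := fun ρ hρ => (dV ρ hρ).continuousAt.continuousWithinAt
  have cV' : ContinuousOn V' (Set.Ioi 0) := by
    have h1 : ∀ ρ ∈ Set.Ioi (0 : ℝ), x * ρ ≠ 0 := fun ρ hρ => (mul_pos hx hρ).ne'
    exact ((continuousOn_const.div (by fun_prop) h1).mul cV).sub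
      ((continuousOn_const.sub (continuousOn_const.div (by fun_prop)
        fun ρ hρ => pow_ne_zero 2 (h1 ρ hρ))).mul cU)
  have cω : ContinuousOn ω (Set.Ioi 0) :=
    (continuousOn_const.mul ((cV.pow 2).sub (cU.mul cV'))).div ((cU.pow 2).add (cV.pow 2)) hN0
  set θ : ℝ → ℝ := fun ρ => ∫ s in r..ρ, ω s with hθ
  have dθ : ∀ ρ > 0, HasDerivAt θ (ω ρ) ρ := by
    intro ρ hρ
    refine intervalIntegral.integral_hasDerivAt_right ?_
      (cω.stronglyMeasurableAtFilter isOpen_Ioi ρ hρ) (cω.continuousAt (Ioi_mem_nhds hρ))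
    exact (cω.mono fun s hs => (lt_min hr hρ).trans_le hs.1).intervalIntegrable
  have θr : θ r = 0 := by simp [hθ]
  -- `S² / N` is the squared sine of the angle between `(U, V)` and `(cos θ, -sin θ)`. It is
  -- constant and vanishes at `r`, so the vectors stay parallel.
  set S : ℝ → ℝ := fun ρ => U ρ * Real.sin (θ ρ) + V ρ * Real.cos (θ ρ) with hS
  have dT : ∀ ρ > 0, HasDerivAt (fun ρ => S ρ ^ 2 / N ρ) 0 ρ := by
    intro ρ hρ
    have dS := ((dU ρ hρ).mul (dθ ρ hρ).sin).add ((dV ρ hρ).mul (dθ ρ hρ).cos)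
    have dN := ((dU ρ hρ).pow 2).add ((dV ρ hρ).pow 2)
    refine ((dS.pow 2).div dN (hN0 ρ hρ)).congr_deriv ?_
    have hn : U ρ ^ 2 + V ρ ^ 2 ≠ 0 := hN0 ρ hρ
    simp only [hω, hN, Pi.add_apply, Pi.mul_apply, Pi.pow_apply]
    generalize U ρ = a at *
    generalize V ρ = b at *
    generalize V' ρ = c at *
    generalize Real.sin (θ ρ) = s at *
    generalize Real.cos (θ ρ) = d at *
    field_simp
    push_cast
    ring
  have S0 : ∀ ρ > 0, S ρ = 0 := by
    intro ρ hρ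
    have h1 : S ρ ^ 2 / N ρ = S r ^ 2 / N r :=
      isOpen_Ioi.is_const_of_deriv_eq_zero (f := fun ρ => S ρ ^ 2 / N ρ)
        (convex_Ioi (0 : ℝ)).isPreconnected
        (fun s hs => (dT s hs).differentiableAt.differentiableWithinAt)
        (fun s hs => (dT s hs).deriv) hρ hr
    have h2 : S r = 0 := by
      have : V r = 0 := hv
      simp [hS, θr, this]
    rw [h2, zero_pow two_ne_zero, zero_div, div_eq_zero_iff] at h1
    exact pow_eq_zero_iff two_ne_zero |>.1 (h1.resolve_right (hN0 ρ hρ))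
  have polar : ∀ ρ > 0, ∃ C : ℝ, C ≠ 0 ∧ U ρ = C * Real.cos (θ ρ) ∧ V ρ = -C * Real.sin (θ ρ) := by
    intro ρ hρ
    have h0 : U ρ * Real.sin (θ ρ) + V ρ * Real.cos (θ ρ) = 0 := S0 ρ hρ
    have h1 := Real.sin_sq_add_cos_sq (θ ρ)
    have eU : U ρ = (U ρ * Real.cos (θ ρ) - V ρ * Real.sin (θ ρ)) * Real.cos (θ ρ) := by
      linear_combination (-U ρ) * h1 + Real.sin (θ ρ) * h0
    have eV : V ρ = -(U ρ * Real.cos (θ ρ) - V ρ * Real.sin (θ ρ)) * Real.sin (θ ρ) := by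
      linear_combination (-V ρ) * h1 + Real.cos (θ ρ) * h0
    refine ⟨_, fun hC => hN0 ρ hρ ?_, eU, eV⟩
    rw [hC] at eU eV
    simp only [hN, eU, eV]
    ring
  refine ⟨θ, θr, fun ρ hρ => (dθ ρ hρ).congr_deriv ?_, fun ρ hρ => ?_⟩
  · obtain ⟨C, hC, eU, eV⟩ := polar ρ hρ
    have h1 := Real.sin_sq_add_cos_sq (θ ρ)
    have eN : N ρ = C ^ 2 := by
      simp only [hN, eU, eV]; linear_combination C ^ 2 * h1
    have hsin : Real.sin (θ ρ) ^ 2 = 1 - Real.cos (θ ρ) ^ 2 := by linarith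
    simp only [hω, eN, hV', phaseField, eU, eV, Real.sin_two_mul]
    generalize Real.sin (θ ρ) = s at *
    generalize Real.cos (θ ρ) = d at *
    have : ρ ≠ 0 := hρ.ne'
    field_simp
    ring_nf
    rw [hsin]
    ring
  · obtain ⟨C, hC, -, eV⟩ := polar ρ hρ
    have : deriv u (x * ρ) = -C * Real.sin (θ ρ) := eV
    rw [this, mul_eq_zero, or_iff_right (neg_ne_zero.2 hC), Real.sin_eq_zero_iff]
    exact exists_congr fun k => eq_comm

/-- The zeros of the cross-product are the points where the phase at `R` is a multiple of `π`. -/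
theorem exists_phase_crossH {ν : ℝ} (hν : 0 ≤ ν) (δ : ℝ) {R r : ℝ} (hr : 0 < r) (hR : 0 < R) :
    ∃ θ : ℝ → ℝ → ℝ, IsPhase (ν ^ 2 - δ ^ 2) (δ + 1 / 2) r θ ∧
      ∀ x > 0, crossH R r ν δ x = 0 ↔ ∃ k : ℤ, θ x R = k * Real.pi := by
  obtain ⟨hJ, hY, hW⟩ := ultra_solutions hν δ
  have main : ∀ x : ℝ, ∃ θ : ℝ → ℝ, 0 < x → θ r = 0 ∧
      (∀ ρ > 0, HasDerivAt θ (phaseField (ν ^ 2 - δ ^ 2) (δ + 1 / 2) x ρ (θ ρ)) ρ) ∧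
      (crossH R r ν δ x = 0 ↔ ∃ k : ℤ, θ R = k * Real.pi) := by
    intro x
    by_cases hx : 0 < x
    swap
    · exact ⟨0, fun h => absurd h hx⟩
    have hrx : 0 < r * x := mul_pos hr hx
    -- With these coefficients the combination has zero derivative at `rx`, and its derivative at
    -- `Rx` is the cross-product.
    set a := deriv (ultraY ν δ) (r * x) with ha
    set b := -deriv (ultraJ ν δ) (r * x) with hb
    have hne : ∀ t > 0, (a * ultraJ ν δ t + b * ultraY ν δ t) ^ 2 +
        deriv (fun t => a * ultraJ ν δ t + b * ultraY ν δ t) t ^ 2 ≠ 0 := by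
      intro t ht h0
      rw [hJ.deriv_linear_comb hY a b ht] at h0
      have h1 : a * ultraJ ν δ t + b * ultraY ν δ t = 0 := by
        refine pow_eq_zero_iff two_ne_zero |>.1 ?_
        nlinarith [sq_nonneg (a * ultraJ ν δ t + b * ultraY ν δ t),
          sq_nonneg (a * deriv (ultraJ ν δ) t + b * deriv (ultraY ν δ) t)]
      have h2 : a * deriv (ultraJ ν δ) t + b * deriv (ultraY ν δ) t = 0 := by
        refine pow_eq_zero_iff two_ne_zero |>.1 ?_
        rw [h1] at h0
        linarith
      have a0 : a = 0 := by
        refine (mul_eq_zero.1 ?_).resolve_right (hW t ht)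
        linear_combination deriv (ultraY ν δ) t * h1 - ultraY ν δ t * h2
      have b0 : b = 0 := by
        refine (mul_eq_zero.1 ?_).resolve_right (hW t ht)
        linear_combination -deriv (ultraJ ν δ) t * h1 + ultraJ ν δ t * h2
      -- If `a` and `b` both vanished, both derivatives at `rx` would, and with them the Wronskian
      -- there.
      refine hW (r * x) hrx ?_
      rw [← ha, a0, ← neg_neg (deriv (ultraJ ν δ) (r * x)), ← hb, b0]
      ring
    obtain ⟨θ, h1, h2, h3⟩ := (hJ.linear_comb hY a b).exists_phase hne hx hr (by
      rw [mul_comm x r, hJ.deriv_linear_comb hY a b hrx, ha, hb]; ring)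
    refine ⟨θ, fun _ => ⟨h1, h2, ?_⟩⟩
    rw [← h3 R hR, mul_comm x R, hJ.deriv_linear_comb hY a b (mul_pos hR hx), crossH, ← ha]
    have : deriv (ultraJ ν δ) (R * x) * a - deriv (ultraJ ν δ) (r * x) * deriv (ultraY ν δ) (R * x)
        = a * deriv (ultraJ ν δ) (R * x) + b * deriv (ultraY ν δ) (R * x) := by rw [hb]; ring
    rw [this]
  choose θ hθ using main
  exact ⟨θ, ⟨fun x hx => (hθ x hx).1, fun x hx => (hθ x hx).2.1⟩, fun x hx => (hθ x hx).2.2⟩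

/-! ### Inverting the phase and numbering the zeros -/

/-- A continuous increasing phase with `Θ x = L x + O(1/x)` takes the values `k π`, `k ≥ n`, at the
points of an increasing sequence `π k / L + O(1/k)`. -/
theorem exists_zero_sequence {Θ : ℝ → ℝ} {L C : ℝ} (n : ℕ) (hL : 0 < L) (hC : 0 ≤ C)
    (hmono : StrictMonoOn Θ (Set.Ioi 0)) (hcont : ContinuousOn Θ (Set.Ioi 0))
    (has : ∀ x ≥ 1, |Θ x - L * x| ≤ C / x)
    (hlow : ∀ x > 0, ∀ k : ℤ, Θ x = k * Real.pi → (n : ℤ) ≤ k)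
    (hex : ∃ x > 0, Θ x ≤ n * Real.pi) :
    ∃ z : ℕ → ℝ, StrictMonoOn z (Set.Ici n) ∧
      z '' Set.Ici n = {x : ℝ | 0 < x ∧ ∃ k : ℤ, Θ x = k * Real.pi} ∧
      (fun k : ℕ => z k - Real.pi / L * (k : ℝ)) =O[atTop] (fun k : ℕ => 1 / (k : ℝ)) := by
  have hπ := Real.pi_pos
  obtain ⟨x₀, hx₀, hΘ₀⟩ := hex
  have hz : ∀ k : ℕ, ∃ x : ℝ, n ≤ k → 0 < x ∧ Θ x = k * Real.pi := by
    intro k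
    by_cases hk : n ≤ k
    swap
    · exact ⟨0, fun h => absurd h hk⟩
    -- Large enough that `Θ y ≥ L y - C ≥ kπ`, so the intermediate value theorem applies on `[x₀,
    -- y]`.
    set y := max (max 1 x₀) ((k * Real.pi + C) / L) with hy
    have hy1 : 1 ≤ y := (le_max_left _ _).trans (le_max_left _ _)
    have hyx : x₀ ≤ y := (le_max_right _ _).trans (le_max_left _ _)
    have hyk : (k * Real.pi + C) / L ≤ y := le_max_right _ _
    have hΘy : k * Real.pi ≤ Θ y := by
      have h1 := (abs_le.1 (has y hy1)).1
      have h2 : C / y ≤ C := div_le_self hC hy1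
      rw [div_le_iff₀ hL] at hyk
      linarith
    have hnk : (n : ℝ) * Real.pi ≤ k * Real.pi := by gcongr
    obtain ⟨x, hx, hxk⟩ := intermediate_value_Icc hyx
      (hcont.mono fun s hs => hx₀.trans_le hs.1) ⟨hΘ₀.trans hnk, hΘy⟩
    exact ⟨x, fun _ => ⟨hx₀.trans_le hx.1, hxk⟩⟩
  choose z hz using hz
  refine ⟨z, fun k hk l hl hkl => ?_, ?_, ?_⟩
  · by_contra! hle
    have h1 := hmono.monotoneOn (hz l hl).1 (hz k hk).1 hle
    rw [(hz l hl).2, (hz k hk).2] at h1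
    have h2 : (l : ℝ) ≤ k := le_of_mul_le_mul_right h1 hπ
    exact absurd (Nat.cast_le.1 h2) (by omega)
  · ext x
    constructor
    · rintro ⟨k, hk, rfl⟩
      exact ⟨(hz k hk).1, k, by simpa using (hz k hk).2⟩
    · rintro ⟨hx, k, hk⟩
      have hnk := hlow x hx k hk
      lift k to ℕ using (Int.natCast_nonneg n).trans hnk
      have hnk' : n ≤ k := by exact_mod_cast hnk
      refine ⟨k, hnk', hmono.injOn (hz k hnk').1 hx ?_⟩
      rw [(hz k hnk').2, hk]
      simp
  · have hD : 0 < (L + C) / Real.pi := by positivity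
    refine Asymptotics.IsBigO.of_bound (C / L * ((L + C) / Real.pi)) ?_
    -- Forces `z k ≥ 1`, the range of the asymptotic bound.
    have hlarge : ∀ᶠ k : ℕ in atTop, Θ 1 ≤ k * Real.pi :=
      (tendsto_natCast_atTop_atTop.atTop_mul_const hπ).eventually_ge_atTop (Θ 1)
    filter_upwards [hlarge, eventually_ge_atTop n, eventually_gt_atTop 0] with k h1 h2 h3
    obtain ⟨hz0, hzk⟩ := hz k h2
    have hk : (0 : ℝ) < k := by exact_mod_cast h3
    have hz1 : 1 ≤ z k := by
      by_contra! hlt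
      have := hmono hz0 (Set.mem_Ioi.2 one_pos) hlt
      rw [hzk] at this
      linarith
    have ha := has (z k) hz1
    rw [hzk] at ha
    -- Converts the error `C / z k` into `O(1/k)`: `kπ ≤ L z k + C / z k ≤ (L + C) z k`.
    have hzlow : 1 / z k ≤ (L + C) / Real.pi * (1 / k) := by
      have h4 : k * Real.pi ≤ (L + C) * z k := by
        have h5 := (abs_le.1 ha).2
        have h6 : C / z k ≤ C * z k := (div_le_self hC hz1).trans (le_mul_of_one_le_right hC hz1)
        linarith
      rw [div_mul_div_comm, mul_one, div_le_div_iff₀ hz0 (by positivity)]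
      linarith
    have e : z k - Real.pi / L * k = -((k * Real.pi - L * z k) / L) := by
      field_simp; ring
    rw [e, norm_neg, Real.norm_eq_abs, abs_div, abs_of_pos hL,
      Real.norm_of_nonneg (by positivity : (0 : ℝ) ≤ 1 / k)]
    calc |k * Real.pi - L * z k| / L ≤ C / z k / L := by gcongr
      _ = C / L * (1 / z k) := by ring
      _ ≤ C / L * ((L + C) / Real.pi * (1 / k)) := by gcongr
      _ = _ := by ring

end BesselCross

theorem mainTheorem9 (R r : ℝ) (hr : 0 < r) (hrR : r < R) (δ ν : ℝ) (hν : |δ| ≤ ν) :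
    ∃ z : ℕ → ℝ, BesselCross.IsPositiveZeroSequence R r ν δ z ∧
      (fun k : ℕ => z k - Real.pi / (R - r) * (k : ℝ)) =O[Filter.atTop]
        (fun k : ℕ => 1 / (k : ℝ)) := by
  have hν0 : 0 ≤ ν := (abs_nonneg δ).trans hν
  have hμ : 0 ≤ ν ^ 2 - δ ^ 2 := sub_nonneg.2 (sq_le_sq.2 (hν.trans (le_abs_self ν)))
  obtain ⟨θ, hθ, hzero⟩ := BesselCross.exists_phase_crossH hν0 δ hr (hr.trans hrR)
  obtain ⟨C, hC, has⟩ := hθ.asymptotic hμ hr hrR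
  have hπ := Real.pi_pos
  -- The first index is the least `k` with `kπ` attained: no smaller multiple occurs, and the phase
  -- starts at or below this one.
  have key : (∀ x > 0, ∀ k : ℤ, θ x R = k * Real.pi → (BesselCross.firstIndex ν δ : ℤ) ≤ k) ∧
      ∃ x > 0, θ x R ≤ BesselCross.firstIndex ν δ * Real.pi := by
    by_cases h : |δ| < ν
    · have hμ' : 0 < ν ^ 2 - δ ^ 2 := sub_pos.2 (sq_lt_sq.2 (h.trans_le (le_abs_self ν)))
      have hi : BesselCross.firstIndex ν δ = 0 := if_pos h
      obtain ⟨x, hx, hx0⟩ := hθ.exists_neg hμ' hr hrR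
      refine ⟨fun x hx k hk => ?_, x, hx, by rw [hi]; simpa using hx0.le⟩
      have h1 := hθ.neg_pi_lt hr hrR hx
      rw [hk] at h1
      have h2 : (-1 : ℝ) < k := by
        by_contra! hle
        nlinarith
      have h3 : (-1 : ℤ) < k := by exact_mod_cast h2
      rw [hi]
      push_cast
      omega
    · have hμ' : ν ^ 2 - δ ^ 2 = 0 := by
        rw [le_antisymm (not_lt.1 h) hν, sq_abs, sub_self]
      have hi : BesselCross.firstIndex ν δ = 1 := if_neg h
      rw [hμ'] at hθ
      obtain ⟨x, hx, hx0⟩ := hθ.exists_lt_pi hr hrR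
      refine ⟨fun x hx k hk => ?_, x, hx, by rw [hi]; simpa using hx0.le⟩
      have h1 := hθ.pos hr hrR hx
      rw [hk] at h1
      have h2 : (0 : ℝ) < k := pos_of_mul_pos_left h1 hπ.le
      have h3 : (0 : ℤ) < k := by exact_mod_cast h2
      rw [hi]
      push_cast
      omega
  obtain ⟨z, hz1, hz2, hz3⟩ := BesselCross.exists_zero_sequence (BesselCross.firstIndex ν δ)
    (sub_pos.2 hrR) hC (hθ.strictMonoOn hμ hr hrR) (hθ.continuousOn hμ hr hrR) has key.1 key.2
  refine ⟨z, ⟨hz1, ?_⟩, hz3⟩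
  rw [hz2]
  ext x
  exact and_congr_right fun hx => (hzero x hx).symm
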